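/- **Setting.** Let $\Gamma=(G,E)$ be a connected, locally finite, countably infinite graph without loops or multiple edges, with symmetric edge weights $\pi_{xy}\ge 0$ such that $\pi_{xy}>0$ if and only if $\{x,y\}\in E$; put $\pi_x=\sum_y\pi_{xy}$. Let $(\theta_x)_{x\in G}$ be positive vertex weights, and let $(X_t)_{t\ge 0}$ be the continuous time simple random walk with generator $(\mathcal L_\theta f)(x)=\frac1{\theta_x}\sum_{y\sim x}\pi_{xy}(f(y)-f(x))$: at $x$ it waits an exponential time of rate $\pi_x/\theta_x$ and then jumps to $y$ with probability $\pi_{xy}/\pi_x$; it is killed at its explosion time, which may be finite. Its heat kernel is $p_t(x,y)=\frac1{\theta_y}\mathbb P^x(X_t=y)$. Let $d_\theta$ be a metric on $G$ with $\frac1{\theta_x}\sum_{y\sim x}\pi_{xy}d_\theta^2(x,y)\le 1$ for all $x\in G$ and $d_\theta(x,y)\le 1$ whenever $x\sim y$. For $A\ge 1$, $\gamma>1$ and $0\le a<b\le\infty$, a monotonically increasing function $g:(a,b)\to(0,\infty)$ is called $(A,\gamma)$-regular on $(a,b)$ if $\frac{g(\gamma t_1)}{g(t_1)}\le A\,\frac{g(\gamma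 t_2)}{g(t_2)}$ for all $a<t_1<t_2<\gamma^{-1}b$. **Theorem.** For every $\gamma>1$ there are constants $\alpha=\alpha(\gamma)>0$ and $C_2=C_2(\gamma)>0$, and for all $A\ge 1$ and $C_\theta>0$ there is a constant $C_1=C_1(A,\gamma,C_\theta)>0$, such that the following holds for all $\Gamma,\pi,\theta,d_\theta$ as above with $\theta_x\ge C_\theta$ for every $x\in G$. Let $0\le T_1<T_2\le\infty$, let $f_1,f_2$ be $(A,\gamma)$-regular on $(T_1,T_2)$ with $$\sup_{t\in(T_1,T_2)}\frac{f_i(t)}{e^{\sqrt t}}\le A\qquad(i=1,2),$$ and let $v_1,v_2\in G$ be vertices with $$p_t(v_i,v_i)\le\frac1{f_i(t)}\qquad\text{for all } t\in(T_1,T_2),\ i=1,2.$$ Then, for all $t$ with $72\gamma^4e^4T_1^2\vee 1\vee d_\theta(v_1,v_2)<t<T_2$, one has $\alpha t\in(T_1,T_2)$ and $$p_t(v_1,v_2)\le\frac{C_1}{\big(f_1(\alpha t)f_2(\alpha t)\big)^{1/2}}\exp\left(-C_2\frac{d_\theta^2(v_1,v_2)}{t}\right).$$ -/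

import Mathlib

open MeasureTheory ProbabilityTheory
open scoped ENNReal

/-- A connected, locally finite weighted graph without loops or multiple edges. The edge weights are
symmetric and nonnegative, and `weight x y` is positive exactly when `x` and `y` are adjacent. -/
structure WeightedGraph (V : Type*) where
  graph : SimpleGraph V
  connected : graph.Connected
  locallyFinite : ∀ x, (graph.neighborSet x).Finite
  weight : V → V → ℝ
  weight_symm : ∀ x y, weight x y = weight y x
  weight_nonneg : ∀ x y, 0 ≤ weight x y
  weight_pos_iff : ∀ x y, 0 < weight x y ↔ graph.Adj x y

namespace WeightedGraph

variable {V : Type*} (Γ : WeightedGraph V)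

/-- The finite set of neighbours of `x`. -/
noncomputable def nbrs (x : V) : Finset V := (Γ.locallyFinite x).toFinset

/-- The weight `π_x` of the vertex `x`, the sum of `π_{xy}` over all `y`
(the terms with `y` not adjacent to `x` vanish). -/
noncomputable def vertexWeight (x : V) : ℝ := ∑ y ∈ Γ.nbrs x, Γ.weight x y

/-- The distribution `P(x, ·)` of a jump from `x`, where `P(x, y) = π_{xy} / π_x`. -/
noncomputable def jumpLaw [MeasurableSpace V] (x : V) : Measure V :=
  ∑ y ∈ Γ.nbrs x, ENNReal.ofReal (Γ.weight x y / Γ.vertexWeight x) • Measure.dirac y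

/-- The law of one instruction at the vertex `x` for the continuous time simple random walk with
vertex weights `θ`: the vertex to jump to, with law `P(x, ·)`, and independently of it the time to
wait at `x` before that jump, which is exponential with rate `π_x / θ_x` (mean `θ_x / π_x`). The rate
of the jump from `x` to `y` is therefore `π_{xy} / θ_x`, which is the entry of the generator
`(L_θ f)(x) = θ_x⁻¹ ∑ y, π_{xy} (f y - f x)`. -/
noncomputable def instructionLaw [MeasurableSpace V] (θ : V → ℝ) (x : V) : Measure (V × ℝ) :=
  (Γ.jumpLaw x).prod (expMeasure (Γ.vertexWeight x / θ x))

/-- The probability measure that drives the walk. A sample point `ω` gives an instruction `ω n x` for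
each `n` and `x`, to be used if `x` is the `n`-th vertex visited; all instructions are independent,
and `ω n x` has the law `instructionLaw θ x`. -/
noncomputable def drivingLaw [MeasurableSpace V] (θ : V → ℝ) : Measure (ℕ → V → V × ℝ) :=
  Measure.infinitePi fun _ : ℕ => Measure.infinitePi fun x : V => Γ.instructionLaw θ x

end WeightedGraph

namespace RandomWalk

variable {V : Type*}

/-- The embedded jump chain: the `n`-th vertex visited by the walk started at `x`. -/
def chain (x : V) (ω : ℕ → V → V × ℝ) : ℕ → V
  | 0 => x
  | n + 1 => (ω n (chain x ω n)).1

/-- The time at which the walk started at `x` arrives at the `n`-th vertex it visits: the sum of the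
first `n` waiting times. -/
noncomputable def arrivalTime (x : V) (ω : ℕ → V → V × ℝ) (n : ℕ) : ℝ :=
  ∑ i ∈ Finset.range n, (ω i (chain x ω i)).2

/-- The event `X_t = y` for the walk `X` started at `x`. The walk is killed at its explosion time
(the supremum of the arrival times), so after that time it is at no vertex. -/
def atEvent (x : V) (t : ℝ) (y : V) : Set (ℕ → V → V × ℝ) :=
  {ω | ∃ n, arrivalTime x ω n ≤ t ∧ t < arrivalTime x ω (n + 1) ∧ chain x ω n = y}

end RandomWalk

namespace WeightedGraph

variable {V : Type*} (Γ : WeightedGraph V)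

/-- The heat kernel `p_t(x, y) = θ_y⁻¹ P^x(X_t = y)` of the continuous time simple random walk on `Γ`
with vertex weights `θ`. -/
noncomputable def heatKernel [MeasurableSpace V] (θ : V → ℝ) (t : ℝ) (x y : V) : ℝ :=
  (Γ.drivingLaw θ).real (RandomWalk.atEvent x t y) / θ y

/-- The condition that the metric of `V` is adapted to the vertex weights `θ`. -/
structure IsAdaptedMetric [MetricSpace V] (θ : V → ℝ) : Prop where
  energy_le_one : ∀ x, 1 / θ x * ∑ y ∈ Γ.nbrs x, Γ.weight x y * dist x y ^ 2 ≤ 1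
  dist_le_one : ∀ x y, Γ.graph.Adj x y → dist x y ≤ 1

/-! The laws above are probability measures, so that `Measure.infinitePi` is the product measure. -/

theorem vertexWeight_pos [Infinite V] (x : V) : 0 < Γ.vertexWeight x := by
  obtain ⟨y, hy⟩ := Γ.connected.preconnected.exists_adj_of_nontrivial x
  refine Finset.sum_pos' (fun z _ => Γ.weight_nonneg x z) ⟨y, ?_, (Γ.weight_pos_iff x y).2 hy⟩
  simpa [nbrs] using hy

theorem isProbabilityMeasure_jumpLaw [Infinite V] [MeasurableSpace V] (x : V) :
    IsProbabilityMeasure (Γ.jumpLaw x) := by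
  have h := Γ.vertexWeight_pos x
  constructor
  simp only [jumpLaw, Measure.coe_finsetSum, Finset.sum_apply, Measure.smul_apply, measure_univ,
    smul_eq_mul, mul_one]
  rw [← ENNReal.ofReal_sum_of_nonneg fun y _ => div_nonneg (Γ.weight_nonneg x y) h.le,
    ← Finset.sum_div]
  change ENNReal.ofReal (Γ.vertexWeight x / Γ.vertexWeight x) = 1
  rw [div_self h.ne', ENNReal.ofReal_one]

theorem isProbabilityMeasure_instructionLaw [Infinite V] [MeasurableSpace V] {θ : V → ℝ}
    (hθ : ∀ x, 0 < θ x) (x : V) : IsProbabilityMeasure (Γ.instructionLaw θ x) := by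
  have := Γ.isProbabilityMeasure_jumpLaw x
  have := isProbabilityMeasure_expMeasure (div_pos (Γ.vertexWeight_pos x) (hθ x))
  unfold instructionLaw
  infer_instance

theorem isProbabilityMeasure_drivingLaw [Infinite V] [MeasurableSpace V] {θ : V → ℝ}
    (hθ : ∀ x, 0 < θ x) : IsProbabilityMeasure (Γ.drivingLaw θ) := by
  have := Γ.isProbabilityMeasure_instructionLaw hθ
  unfold drivingLaw
  infer_instance

end WeightedGraph

/-- The open interval `(a, b)` of real times, where `b` may be infinite. -/
def timeInterval (a : ℝ) (b : EReal) : Set ℝ := {t | a < t ∧ (t : EReal) < b}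

/-- The function `g` is `(A, γ)`-regular on `(a, b)`, where `A ≥ 1`, `γ > 1` and `0 ≤ a < b ≤ ∞`. Only
the values of `g` on `(a, b)` matter; the condition `t₂ < γ⁻¹ b` is written as `γ t₂ < b`. -/
structure IsRegularOn (A γ a : ℝ) (b : EReal) (g : ℝ → ℝ) : Prop where
  one_le : 1 ≤ A
  one_lt : 1 < γ
  nonneg : 0 ≤ a
  lt : (a : EReal) < b
  pos : ∀ t ∈ timeInterval a b, 0 < g t
  monotoneOn : MonotoneOn g (timeInterval a b)
  ratio_le : ∀ t₁ t₂ : ℝ, a < t₁ → t₁ < t₂ → ((γ * t₂ : ℝ) : EReal) < b →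
    g (γ * t₁) / g t₁ ≤ A * (g (γ * t₂) / g t₂)

/-! The walk killed on leaving a finite set `B` has transition matrix `exp (t L_B)`, and its kernels
increase to the heat kernel as `B` grows. So it suffices to bound the killed kernels uniformly in
`B`, where all sums are finite, and they inherit the on-diagonal bounds.

For a killed kernel, Davies' estimate yields the integral maximum principle
`killedEnergy_le_exp_mul`: if `ξ` has Lipschitz constant `l ≤ 1`, the `e^ξ`-weighted `ℓ²(θ)` energy
grows by a factor of at most `e^{l²(t-s)}` on `[s, t]`. The restriction `l ≤ 1` comes from the
discreteness: `cosh` is comparable to a quadratic only on bounded increments. Truncated linear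
weights turn this into a one-step inequality for the mass at distance at least `R`
(`killedTail_le_step`) and an a priori exponential bound (`killedTail_le_exp`).

Grigor'yan's iteration (`tail_le_of_iteration`) applies the step along geometrically decreasing
times. It stops once the time is comparable to `R`, where the slope would exceed 1, and the a priori
bound takes over; the growth condition `f t ≤ A e^{√t}` makes that bound strong enough.

Regularity of `f` controls the on-diagonal values along the iteration by powers of `A Q`, with `Q =
f t / f (t / γ)`. If `A Q` is at most `e^{bX}`, where `X` is of order `R² / t`, the iteration
absorbs these powers. Otherwise `f` has grown so much that the on-diagonal bound at `t` alone gives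
the Gaussian factor relative to `f (t / γ)`. This dichotomy keeps the Gaussian exponent independent
of `A`.

Finally, every vertex is at distance at least `d(v₁, v₂) / 2` from `v₁` or `v₂`, so
Chapman–Kolmogorov and Cauchy–Schwarz bound `p_t(v₁, v₂)` by tails times on-diagonal values. -/

/-! ### Entries of matrix exponentials. -/

theorem Matrix.exp_apply_nonneg {n : Type*} [Fintype n] [DecidableEq n] {M : Matrix n n ℝ}
    (hM : ∀ i j, 0 ≤ M i j) (i j : n) : 0 ≤ NormedSpace.exp M i j := by
  let := Matrix.linftyOpNormedRing (n := n) (α := ℝ)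
  let := Matrix.linftyOpNormedAlgebra (n := n) (R := ℝ) (α := ℝ)
  have hpow : ∀ k : ℕ, ∀ i j, 0 ≤ (M ^ k) i j := by
    intro k
    induction k with
    | zero => intro i j; rw [pow_zero, Matrix.one_apply]; split_ifs <;> norm_num
    | succ k ih =>
      intro i j
      rw [pow_succ, Matrix.mul_apply]
      exact Finset.sum_nonneg fun l _ => mul_nonneg (ih i l) (hM l j)
  have h := NormedSpace.exp_series_hasSum_exp' (𝕂 := ℝ) M
  have h2 := Pi.hasSum.1 (Pi.hasSum.1 h i) j
  refine h2.nonneg fun k => ?_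
  simp only [Matrix.smul_apply, smul_eq_mul]
  exact mul_nonneg (by positivity) (hpow k i j)

/-- Adding a large multiple of the identity makes every entry nonnegative and only multiplies the
exponential by a positive scalar. -/
theorem Matrix.exp_smul_apply_nonneg {n : Type*} [Fintype n] [DecidableEq n] {M : Matrix n n ℝ}
    (hM : ∀ i j, i ≠ j → 0 ≤ M i j) {t : ℝ} (ht : 0 ≤ t) (i j : n) :
    0 ≤ NormedSpace.exp (t • M) i j := by
  have h3 : ∀ r : ℝ, NormedSpace.exp (algebraMap ℝ (Matrix n n ℝ) r) =
      algebraMap ℝ (Matrix n n ℝ) (NormedSpace.exp r) := by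
    let := Matrix.linftyOpNormedRing (n := n) (α := ℝ)
    let := Matrix.linftyOpNormedAlgebra (n := n) (R := ℝ) (α := ℝ)
    exact fun r => (NormedSpace.algebraMap_exp_comm r).symm
  set c : ℝ := ∑ i, |M i i| with hc
  have hc' : ∀ i, 0 ≤ M i i + c := fun i => by
    have := Finset.single_le_sum (f := fun i => |M i i|) (fun i _ => abs_nonneg _)
      (Finset.mem_univ i)
    have h2 := neg_abs_le (M i i)
    linarith
  have h1 : t • M = t • (M + c • (1 : Matrix n n ℝ)) + algebraMap ℝ (Matrix n n ℝ) (-(t * c)) := by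
    rw [Algebra.algebraMap_eq_smul_one, smul_add, smul_smul, neg_smul]
    abel
  have h2 : NormedSpace.exp (t • M) =
      Real.exp (-(t * c)) • NormedSpace.exp (t • (M + c • (1 : Matrix n n ℝ))) := by
    rw [h1, Matrix.exp_add_of_commute _ _ (Algebra.commute_algebraMap_right (-(t * c)) _), Real.exp_eq_exp_ℝ]
    rw [h3, Algebra.algebraMap_eq_smul_one, mul_smul_comm, mul_one]
  rw [h2, Matrix.smul_apply, smul_eq_mul]
  refine mul_nonneg (Real.exp_pos _).le (Matrix.exp_apply_nonneg (fun i j => ?_) i j)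
  rw [Matrix.smul_apply, smul_eq_mul]
  refine mul_nonneg ht ?_
  by_cases hij : i = j
  · subst hij; simpa using hc' i
  · simpa [Matrix.one_apply, hij] using hM i j hij

theorem Matrix.hasDerivAt_exp_smul_apply {n : Type*} [Fintype n] [DecidableEq n]
    (M : Matrix n n ℝ) (i j : n) (t : ℝ) :
    HasDerivAt (fun t : ℝ => NormedSpace.exp (t • M) i j)
      (∑ k, M i k * NormedSpace.exp (t • M) k j) t := by
  let := Matrix.linftyOpNormedRing (n := n) (α := ℝ)
  let := Matrix.linftyOpNormedAlgebra (n := n) (R := ℝ) (α := ℝ)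
  exact hasDerivAt_pi.1 (hasDerivAt_pi.1 (hasDerivAt_exp_smul_const' (𝕂 := ℝ) M t) i) j

/-! ### The walk killed outside a finite set: semigroup, reversibility, backward equation. -/

namespace WeightedGraph

variable {V : Type*} (Γ : WeightedGraph V)

theorem mem_nbrs {x y : V} : y ∈ Γ.nbrs x ↔ Γ.graph.Adj x y := by
  simp [nbrs]

theorem weight_eq_zero_of_notMem_nbrs {x y : V} (h : y ∉ Γ.nbrs x) : Γ.weight x y = 0 := by
  by_contra h0
  exact h (Γ.mem_nbrs.2
    ((Γ.weight_pos_iff x y).1 (lt_of_le_of_ne (Γ.weight_nonneg x y) (Ne.symm h0))))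

theorem sum_nbrs_eq_sum_of_eq_zero (x : V) (B : Finset V) (g : V → ℝ) (hg : ∀ y ∉ B, g y = 0) :
    ∑ y ∈ Γ.nbrs x, Γ.weight x y * g y = ∑ y ∈ B, Γ.weight x y * g y := by
  classical
  rw [← Finset.sum_inter_add_sum_sdiff (Γ.nbrs x) B,
    ← Finset.sum_inter_add_sum_sdiff B (Γ.nbrs x), Finset.inter_comm]
  congr 1
  rw [Finset.sum_eq_zero, Finset.sum_eq_zero]
  · intro y hy
    rw [Γ.weight_eq_zero_of_notMem_nbrs (Finset.mem_sdiff.1 hy).2, zero_mul]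
  · intro y hy
    rw [hg y (Finset.mem_sdiff.1 hy).2, mul_zero]

open Classical in
/-- The generator of the walk killed on leaving the finite set `B`. -/
noncomputable def killedGenerator (θ : V → ℝ) (B : Finset V) : Matrix B B ℝ :=
  Matrix.of fun x y => (Γ.weight x y - if x = y then Γ.vertexWeight x else 0) / θ x

open Classical in
theorem killedGenerator_apply (θ : V → ℝ) (B : Finset V) (x y : B) :
    Γ.killedGenerator θ B x y =
      (Γ.weight x y - if x = y then Γ.vertexWeight x else 0) / θ x := rfl

open Classical in
/-- The transition function of the walk killed on leaving the finite set `B`, extended by zero. -/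
noncomputable def killedTransition (θ : V → ℝ) (B : Finset V) (t : ℝ) (x y : V) : ℝ :=
  if h : x ∈ B ∧ y ∈ B then
    NormedSpace.exp (t • Γ.killedGenerator θ B) ⟨x, h.1⟩ ⟨y, h.2⟩ else 0

variable {Γ} {θ : V → ℝ} {B : Finset V}

theorem killedTransition_of_mem {t : ℝ} {x y : V} (hx : x ∈ B) (hy : y ∈ B) [DecidableEq B] :
    Γ.killedTransition θ B t x y =
      NormedSpace.exp (t • Γ.killedGenerator θ B) ⟨x, hx⟩ ⟨y, hy⟩ := by
  rw [killedTransition, dif_pos ⟨hx, hy⟩]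
  congr!

theorem killedTransition_of_notMem_left {t : ℝ} {x y : V} (hx : x ∉ B) :
    Γ.killedTransition θ B t x y = 0 :=
  dif_neg fun h => hx h.1

theorem killedTransition_of_notMem_right {t : ℝ} {x y : V} (hy : y ∉ B) :
    Γ.killedTransition θ B t x y = 0 :=
  dif_neg fun h => hy h.2

theorem killedTransition_zero [DecidableEq V] {x y : V} (hx : x ∈ B) :
    Γ.killedTransition θ B 0 x y = if x = y then 1 else 0 := by
  classical
  by_cases hy : y ∈ B
  · rw [killedTransition_of_mem hx hy, zero_smul, NormedSpace.exp_zero, Matrix.one_apply]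
    simp
  · rw [killedTransition_of_notMem_right hy, if_neg]
    rintro rfl
    exact hy hx

theorem killedTransition_nonneg (hθ : ∀ x, 0 < θ x) {t : ℝ} (ht : 0 ≤ t) (x y : V) :
    0 ≤ Γ.killedTransition θ B t x y := by
  classical
  rw [killedTransition]
  split_ifs with h
  · refine Matrix.exp_smul_apply_nonneg (fun i j hij => ?_) ht _ _
    simp only [killedGenerator_apply, if_neg hij, sub_zero]
    exact div_nonneg (Γ.weight_nonneg _ _) (hθ _).le
  · exact le_rfl

theorem killedTransition_add (s t : ℝ) (x y : V) :
    Γ.killedTransition θ B (s + t) x y =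
      ∑ z ∈ B, Γ.killedTransition θ B s x z * Γ.killedTransition θ B t z y := by
  classical
  by_cases hx : x ∈ B
  · by_cases hy : y ∈ B
    · rw [killedTransition_of_mem hx hy, add_smul, Matrix.exp_add_of_commute _ _
        ((Commute.refl _).smul_left _ |>.smul_right _), Matrix.mul_apply, ← Finset.sum_coe_sort B]
      exact Finset.sum_congr rfl fun z _ => by
        rw [killedTransition_of_mem hx z.2, killedTransition_of_mem z.2 hy]
    · simp [killedTransition_of_notMem_right hy]
  · simp [killedTransition_of_notMem_left hx]

/-- Detailed balance `D L = Lᵀ D`, with `D` the diagonal matrix of `θ`, says that `D` conjugates `L`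
into its transpose; conjugation commutes with the exponential. -/
theorem killedTransition_symm (hθ : ∀ x, 0 < θ x) (t : ℝ) (x y : V) :
    θ x * Γ.killedTransition θ B t x y = θ y * Γ.killedTransition θ B t y x := by
  classical
  by_cases hx : x ∈ B
  · by_cases hy : y ∈ B
    · rw [killedTransition_of_mem hx hy, killedTransition_of_mem hy hx]
      set L := Γ.killedGenerator θ B
      set D : Matrix B B ℝ := Matrix.diagonal fun x => θ x
      have hD : IsUnit D := by
        rw [Matrix.isUnit_iff_isUnit_det, Matrix.det_diagonal]
        exact (Finset.prod_ne_zero_iff.2 fun (x : B) _ => (hθ x).ne').isUnit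
      have hDet := (Matrix.isUnit_iff_isUnit_det D).1 hD
      have h1 : D * L = L.transpose * D := by
        ext i j
        simp only [D, L, Matrix.diagonal_mul, Matrix.mul_diagonal, Matrix.transpose_apply,
          killedGenerator_apply]
        rw [mul_div_cancel₀ _ (hθ _).ne', div_mul_cancel₀ _ (hθ _).ne', Γ.weight_symm]
        by_cases hij : i = j
        · subst hij; rfl
        · rw [if_neg hij, if_neg (Ne.symm hij)]
      have h2 : D * L * D⁻¹ = L.transpose := by
        rw [h1, mul_assoc, Matrix.mul_nonsing_inv _ hDet, mul_one]
      have h3 : D * NormedSpace.exp (t • L) = (NormedSpace.exp (t • L)).transpose * D := by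
        rw [← Matrix.exp_transpose, Matrix.transpose_smul, ← h2, ← Matrix.smul_mul,
          ← Matrix.mul_smul, Matrix.exp_conj _ _ hD, mul_assoc, Matrix.nonsing_inv_mul _ hDet,
          mul_one]
      have h4 := congrFun (congrFun h3 ⟨x, hx⟩) ⟨y, hy⟩
      simp only [D, Matrix.diagonal_mul, Matrix.mul_diagonal, Matrix.transpose_apply] at h4
      rw [h4, mul_comm]
    · simp [killedTransition_of_notMem_right hy, killedTransition_of_notMem_left hy]
  · simp [killedTransition_of_notMem_right hx, killedTransition_of_notMem_left hx]

theorem hasDerivAt_killedTransition {x : V} (hx : x ∈ B) (y : V) (t : ℝ) :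
    HasDerivAt (fun t => Γ.killedTransition θ B t x y)
      ((∑ z ∈ Γ.nbrs x, Γ.weight x z *
        (Γ.killedTransition θ B t z y - Γ.killedTransition θ B t x y)) / θ x) t := by
  classical
  by_cases hy : y ∈ B
  · have h2 := Matrix.hasDerivAt_exp_smul_apply (Γ.killedGenerator θ B) ⟨x, hx⟩ ⟨y, hy⟩ t
    have h3 : (fun t => Γ.killedTransition θ B t x y) = fun t =>
        NormedSpace.exp (t • Γ.killedGenerator θ B) ⟨x, hx⟩ ⟨y, hy⟩ := by
      funext t
      rw [killedTransition_of_mem hx hy]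
    rw [h3]
    refine h2.congr_deriv ?_
    simp only [mul_sub, Finset.sum_sub_distrib, ← Finset.sum_mul]
    rw [Γ.sum_nbrs_eq_sum_of_eq_zero x B _ fun z hz => killedTransition_of_notMem_left hz,
      ← Finset.sum_coe_sort B, ← vertexWeight]
    simp only [killedGenerator_apply, sub_div, sub_mul, Finset.sum_sub_distrib,
      Finset.sum_div]
    congr 1
    · exact Finset.sum_congr rfl fun z _ => by
        rw [killedTransition_of_mem z.2 hy]
        ring
    · simp only [ite_div, zero_div, ite_mul, zero_mul, Finset.sum_ite_eq, Finset.mem_univ, if_true]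
      rw [killedTransition_of_mem hx hy]
      ring
  · simp only [killedTransition_of_notMem_right hy]
    simpa using hasDerivAt_const t (0 : ℝ)

end WeightedGraph

/-! ### Davies' estimate and the integral maximum principle. -/

theorem Real.two_mul_cosh_half_sub_two_le {z : ℝ} (hz : |z| ≤ 1) :
    2 * Real.cosh (z / 2) - 2 ≤ z ^ 2 := by
  have h1 := Real.cosh_le_exp_half_sq (z / 2)
  have hz2 : z ^ 2 ≤ 1 := (sq_le_one_iff_abs_le_one z).2 hz
  have h2 : |(z / 2) ^ 2 / 2| ≤ 1 := by
    rw [abs_of_nonneg (by positivity)]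
    nlinarith
  have h3 := (abs_le.1 (Real.abs_exp_sub_one_le h2)).2
  rw [abs_of_nonneg (by positivity)] at h3
  nlinarith [sq_nonneg z]

namespace WeightedGraph

variable {V : Type*} {Γ : WeightedGraph V} {θ : V → ℝ} {B : Finset V}

/-- Davies' estimate for the Dirichlet form perturbed by the weight `e^ξ`. -/
theorem sum_mul_exp_mul_laplacian_le (u ξ : V → ℝ) (hu : ∀ x ∉ B, u x = 0) :
    2 * ∑ x ∈ B, u x * Real.exp (ξ x) * ∑ y ∈ Γ.nbrs x, Γ.weight x y * (u y - u x) ≤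
      ∑ x ∈ B, u x ^ 2 * Real.exp (ξ x) *
        ∑ y ∈ Γ.nbrs x, Γ.weight x y * (2 * Real.cosh ((ξ x - ξ y) / 2) - 2) := by
  -- The substitution `a = u e^{ξ/2}` makes the cross terms symmetric in `x` and `y`, up to the
  -- factor `2 cosh ((ξ x - ξ y) / 2)`.
  set a : V → ℝ := fun x => u x * Real.exp (ξ x / 2) with ha
  have hsq : ∀ x, Real.exp (ξ x / 2) ^ 2 = Real.exp (ξ x) := fun x => by
    rw [← Real.exp_nat_mul]; congr 1; push_cast; ring
  have hcosh : ∀ x y, u x * u y * (Real.exp (ξ x) + Real.exp (ξ y)) =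
      a x * a y * (2 * Real.cosh ((ξ x - ξ y) / 2)) := fun x y => by
    have e1 : Real.exp (ξ x / 2) * Real.exp (ξ y / 2) * Real.exp ((ξ x - ξ y) / 2) =
        Real.exp (ξ x) := by rw [← Real.exp_add, ← Real.exp_add]; congr 1; ring
    have e2 : Real.exp (ξ x / 2) * Real.exp (ξ y / 2) * Real.exp (-((ξ x - ξ y) / 2)) =
        Real.exp (ξ y) := by rw [← Real.exp_add, ← Real.exp_add]; congr 1; ring
    rw [Real.cosh_eq, ← e1, ← e2, ha]
    ring
  have hsym : ∀ F : V → V → ℝ, ∑ x ∈ B, ∑ y ∈ B, Γ.weight x y * F x y =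
      ∑ x ∈ B, ∑ y ∈ B, Γ.weight x y * F y x := fun F => by
    rw [Finset.sum_comm]
    exact Finset.sum_congr rfl fun x _ => Finset.sum_congr rfl fun y _ => by
      rw [Γ.weight_symm]
  -- Symmetrise using the symmetry of the weights, then apply `2 a x a y ≤ a x ^ 2 + a y ^ 2`.
  have hcross : 2 * ∑ x ∈ B, ∑ y ∈ B, Γ.weight x y * (u x * u y * Real.exp (ξ x)) ≤
      ∑ x ∈ B, ∑ y ∈ B, Γ.weight x y * (a x ^ 2 * (2 * Real.cosh ((ξ x - ξ y) / 2))) := by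
    have h1 : 2 * ∑ x ∈ B, ∑ y ∈ B, Γ.weight x y * (u x * u y * Real.exp (ξ x)) =
        ∑ x ∈ B, ∑ y ∈ B, Γ.weight x y * (a x * a y * (2 * Real.cosh ((ξ x - ξ y) / 2))) := by
      rw [two_mul]
      nth_rewrite 2 [hsym]
      simp only [← Finset.sum_add_distrib]
      exact Finset.sum_congr rfl fun x _ => Finset.sum_congr rfl fun y _ => by
        rw [← hcosh]; ring
    have h2 : 2 * ∑ x ∈ B, ∑ y ∈ B,
        Γ.weight x y * (a x ^ 2 * (2 * Real.cosh ((ξ x - ξ y) / 2))) =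
        ∑ x ∈ B, ∑ y ∈ B,
          Γ.weight x y * ((a x ^ 2 + a y ^ 2) * (2 * Real.cosh ((ξ x - ξ y) / 2))) := by
      rw [two_mul]
      nth_rewrite 2 [hsym]
      simp only [← Finset.sum_add_distrib]
      refine Finset.sum_congr rfl fun x _ => Finset.sum_congr rfl fun y _ => ?_
      rw [← Real.cosh_neg ((ξ y - ξ x) / 2), show -((ξ y - ξ x) / 2) = (ξ x - ξ y) / 2 by ring]
      ring
    have h3 : 2 * ∑ x ∈ B, ∑ y ∈ B, Γ.weight x y * (a x * a y * (2 * Real.cosh ((ξ x - ξ y) / 2)))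
        ≤ 2 * ∑ x ∈ B, ∑ y ∈ B,
          Γ.weight x y * (a x ^ 2 * (2 * Real.cosh ((ξ x - ξ y) / 2))) := by
      rw [h2]
      simp only [Finset.mul_sum]
      refine Finset.sum_le_sum fun x _ => Finset.sum_le_sum fun y _ => ?_
      have hw := mul_nonneg (Γ.weight_nonneg x y) (Real.cosh_pos ((ξ x - ξ y) / 2)).le
      nlinarith [mul_nonneg hw (sq_nonneg (a x - a y))]
    linarith
  have hle : ∑ x ∈ B, ∑ y ∈ B, Γ.weight x y * (a x ^ 2 * (2 * Real.cosh ((ξ x - ξ y) / 2))) ≤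
      ∑ x ∈ B, u x ^ 2 * Real.exp (ξ x) *
        ∑ y ∈ Γ.nbrs x, Γ.weight x y * (2 * Real.cosh ((ξ x - ξ y) / 2)) := by
    classical
    refine Finset.sum_le_sum fun x _ => ?_
    have hax : a x ^ 2 = u x ^ 2 * Real.exp (ξ x) := by rw [ha, mul_pow, hsq]
    have h0 : ∀ y, 0 ≤ Γ.weight x y * (2 * Real.cosh ((ξ x - ξ y) / 2)) := fun y =>
      mul_nonneg (Γ.weight_nonneg x y) (by positivity)
    calc ∑ y ∈ B, Γ.weight x y * (a x ^ 2 * (2 * Real.cosh ((ξ x - ξ y) / 2)))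
        = a x ^ 2 * ∑ y ∈ B, Γ.weight x y * (2 * Real.cosh ((ξ x - ξ y) / 2)) := by
          rw [Finset.mul_sum]
          exact Finset.sum_congr rfl fun y _ => by ring
      _ ≤ a x ^ 2 * ∑ y ∈ Γ.nbrs x, Γ.weight x y * (2 * Real.cosh ((ξ x - ξ y) / 2)) := by
          refine mul_le_mul_of_nonneg_left ?_ (sq_nonneg _)
          rw [← Finset.sum_inter_add_sum_sdiff B (Γ.nbrs x),
            Finset.sum_eq_zero (s := B \ Γ.nbrs x), add_zero]
          · exact Finset.sum_le_sum_of_subset_of_nonneg Finset.inter_subset_right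
              fun y _ _ => h0 y
          · intro y hy
            rw [Γ.weight_eq_zero_of_notMem_nbrs (Finset.mem_sdiff.1 hy).2, zero_mul]
      _ = _ := by rw [hax]
  have hL : 2 * ∑ x ∈ B, u x * Real.exp (ξ x) * ∑ y ∈ Γ.nbrs x, Γ.weight x y * (u y - u x) =
      2 * ∑ x ∈ B, ∑ y ∈ B, Γ.weight x y * (u x * u y * Real.exp (ξ x)) -
      ∑ x ∈ B, u x ^ 2 * Real.exp (ξ x) * ∑ y ∈ Γ.nbrs x, Γ.weight x y * 2 := by
    simp only [mul_sub, Finset.sum_sub_distrib]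
    congr 1
    · congr 1
      refine Finset.sum_congr rfl fun x _ => ?_
      rw [Γ.sum_nbrs_eq_sum_of_eq_zero x B u hu, Finset.mul_sum]
      exact Finset.sum_congr rfl fun y _ => by ring
    · rw [Finset.mul_sum]
      refine Finset.sum_congr rfl fun x _ => ?_
      rw [← Finset.sum_mul, ← Finset.sum_mul]
      ring
  have hR : ∑ x ∈ B, u x ^ 2 * Real.exp (ξ x) *
        ∑ y ∈ Γ.nbrs x, Γ.weight x y * (2 * Real.cosh ((ξ x - ξ y) / 2) - 2) =
      ∑ x ∈ B, u x ^ 2 * Real.exp (ξ x) *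
        ∑ y ∈ Γ.nbrs x, Γ.weight x y * (2 * Real.cosh ((ξ x - ξ y) / 2)) -
      ∑ x ∈ B, u x ^ 2 * Real.exp (ξ x) * ∑ y ∈ Γ.nbrs x, Γ.weight x y * 2 := by
    rw [← Finset.sum_sub_distrib]
    refine Finset.sum_congr rfl fun x _ => ?_
    rw [← mul_sub, ← Finset.sum_sub_distrib]
    congr 1
    exact Finset.sum_congr rfl fun y _ => by ring
  linarith

variable (Γ θ B) in
/-- The weighted energy `∑ x, p_t(x, v)² e^{ξ(x)} θ_x` of the heat kernel `p_t(x, v)` of the walk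
killed on leaving `B`. -/
noncomputable def killedEnergy (v : V) (ξ : V → ℝ) (t : ℝ) : ℝ :=
  ∑ x ∈ B, (Γ.killedTransition θ B t x v / θ v) ^ 2 * Real.exp (ξ x) * θ x

/-- The integral maximum principle. -/
theorem killedEnergy_le_exp_mul [MetricSpace V] (hθ : ∀ x, 0 < θ x) (hd : Γ.IsAdaptedMetric θ)
    (v : V) {ξ : V → ℝ} {l : ℝ} (hl : l ≤ 1) (hξ : ∀ x y, |ξ x - ξ y| ≤ l * dist x y)
    {s t : ℝ} (hst : s ≤ t) :
    Γ.killedEnergy θ B v ξ t ≤ Real.exp (l ^ 2 * (t - s)) * Γ.killedEnergy θ B v ξ s := by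
  set u : ℝ → V → ℝ := fun t x => Γ.killedTransition θ B t x v / θ v with hu
  have hder : ∀ t, HasDerivAt (fun t => Γ.killedEnergy θ B v ξ t)
      (2 * ∑ x ∈ B, u t x * Real.exp (ξ x) * ∑ y ∈ Γ.nbrs x, Γ.weight x y * (u t y - u t x)) t := by
    intro t
    rw [Finset.mul_sum]
    refine HasDerivAt.fun_sum fun x hx => ?_
    have h1 := (((hasDerivAt_killedTransition (Γ := Γ) (θ := θ) hx v t).div_const (θ v)).fun_pow 2
      |>.mul_const (Real.exp (ξ x))).mul_const (θ x)
    refine h1.congr_deriv ?_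
    have h2 : ∑ y ∈ Γ.nbrs x, Γ.weight x y * (u t y - u t x) = (∑ y ∈ Γ.nbrs x, Γ.weight x y *
        (Γ.killedTransition θ B t y v - Γ.killedTransition θ B t x v)) / θ v := by
      rw [Finset.sum_div]
      exact Finset.sum_congr rfl fun y _ => by simp only [hu]; ring
    rw [h2]
    simp only [hu]
    have := (hθ x).ne'
    field_simp
    push_cast
    ring
  have hbound : ∀ t, 2 * ∑ x ∈ B, u t x * Real.exp (ξ x) *
      ∑ y ∈ Γ.nbrs x, Γ.weight x y * (u t y - u t x) ≤ l ^ 2 * Γ.killedEnergy θ B v ξ t := by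
    intro t
    refine (sum_mul_exp_mul_laplacian_le (u t) ξ fun x hx => ?_).trans ?_
    · simp only [hu]; rw [killedTransition_of_notMem_left hx, zero_div]
    · rw [killedEnergy, Finset.mul_sum]
      refine Finset.sum_le_sum fun x _ => ?_
      have h1 : ∑ y ∈ Γ.nbrs x, Γ.weight x y * (2 * Real.cosh ((ξ x - ξ y) / 2) - 2) ≤
          l ^ 2 * θ x := by
        have h2 := hd.energy_le_one x
        rw [one_div, inv_mul_le_iff₀ (hθ x), mul_one] at h2
        calc _ ≤ ∑ y ∈ Γ.nbrs x, l ^ 2 * (Γ.weight x y * dist x y ^ 2) := by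
              refine Finset.sum_le_sum fun y hy => ?_
              have hxy := hξ x y
              have hadj := Γ.mem_nbrs.1 hy
              have hd1 := hd.dist_le_one x y hadj
              have hdpos : 0 < dist x y := dist_pos.2 hadj.ne
              have hl0 : 0 ≤ l := by
                by_contra! h
                have := abs_nonneg (ξ x - ξ y)
                nlinarith
              have h3 := Real.two_mul_cosh_half_sub_two_le (z := ξ x - ξ y)
                (hxy.trans (mul_le_one₀ hl dist_nonneg hd1))
              have h4 : (ξ x - ξ y) ^ 2 ≤ l ^ 2 * dist x y ^ 2 := by
                rw [← mul_pow, ← sq_abs]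
                exact pow_le_pow_left₀ (abs_nonneg _) hxy 2
              have := mul_le_mul_of_nonneg_left (h3.trans h4) (Γ.weight_nonneg x y)
              linarith
          _ = l ^ 2 * ∑ y ∈ Γ.nbrs x, Γ.weight x y * dist x y ^ 2 := by rw [Finset.mul_sum]
          _ ≤ _ := by gcongr
      calc _ ≤ u t x ^ 2 * Real.exp (ξ x) * (l ^ 2 * θ x) := by gcongr
        _ = _ := by ring
  -- Grönwall: `hbound` is the differential inequality `E' ≤ l² E`.
  have hanti : Antitone fun t => Real.exp (-(l ^ 2 * t)) * Γ.killedEnergy θ B v ξ t := by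
    have hder' := fun t => (((hasDerivAt_id t).const_mul (l ^ 2)).neg.exp).mul (hder t)
    refine antitone_of_hasDerivAt_nonpos hder' fun t => ?_
    have h1 := mul_le_mul_of_nonneg_left (hbound t) (Real.exp_pos (-(l ^ 2 * t))).le
    simp only [Pi.neg_apply, Pi.zero_apply, id]
    linarith
  have h := hanti hst
  simp only at h
  rw [Real.exp_neg, inv_mul_le_iff₀ (Real.exp_pos _), ← mul_assoc, ← Real.exp_add] at h
  rwa [show l ^ 2 * t + -(l ^ 2 * s) = l ^ 2 * (t - s) by ring] at h

/-- Chapman–Kolmogorov and reversibility: the squared norm at time `t` is the on-diagonal kernel at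
time `2t`. Through this identity the on-diagonal bounds enter. -/
theorem killedEnergy_zero (hθ : ∀ x, 0 < θ x) (v : V) (t : ℝ) :
    Γ.killedEnergy θ B v (fun _ => 0) t = Γ.killedTransition θ B (t + t) v v / θ v := by
  rw [killedEnergy, killedTransition_add, Finset.sum_div]
  refine Finset.sum_congr rfl fun z _ => ?_
  have h := killedTransition_symm (Γ := Γ) (B := B) hθ t v z
  have h2 : Γ.killedTransition θ B t v z = θ z * Γ.killedTransition θ B t z v / θ v := by
    rw [← h, mul_div_cancel_left₀ _ (hθ v).ne']
  rw [h2, Real.exp_zero]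
  ring

/-! ### Tails of the killed heat kernel. -/

variable (Γ θ B) in
open Classical in
/-- The part of the squared `ℓ²(θ)` norm of the killed heat kernel `p_t(·, v)` that sits at distance
at least `R` from `v`. -/
noncomputable def killedTail [MetricSpace V] (v : V) (R t : ℝ) : ℝ :=
  ∑ x ∈ B with R ≤ dist v x, (Γ.killedTransition θ B t x v / θ v) ^ 2 * θ x

theorem killedTail_le_energy [MetricSpace V] (hθ : ∀ x, 0 < θ x) {v : V} {R t : ℝ} {ξ : V → ℝ}
    (hξ : ∀ x, R ≤ dist v x → 0 ≤ ξ x) :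
    Γ.killedTail θ B v R t ≤ Γ.killedEnergy θ B v ξ t := by
  classical
  rw [killedTail, killedEnergy]
  calc _ ≤ ∑ x ∈ B with R ≤ dist v x,
        (Γ.killedTransition θ B t x v / θ v) ^ 2 * Real.exp (ξ x) * θ x := by
        refine Finset.sum_le_sum fun x hx => ?_
        have := Real.one_le_exp (hξ x (Finset.mem_filter.1 hx).2)
        have := (hθ x).le
        gcongr
        exact le_mul_of_one_le_right (sq_nonneg _) ‹_›
    _ ≤ _ := Finset.sum_le_sum_of_subset_of_nonneg (Finset.filter_subset _ _) fun x _ _ => by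
        have := (hθ x).le
        positivity

theorem killedTail_le_killedTransition [MetricSpace V] (hθ : ∀ x, 0 < θ x) (v : V) (R t : ℝ) :
    Γ.killedTail θ B v R t ≤ Γ.killedTransition θ B (t + t) v v / θ v := by
  rw [← killedEnergy_zero hθ]
  exact killedTail_le_energy hθ fun _ _ => le_rfl

theorem abs_mul_min_sub_le [MetricSpace V] {l : ℝ} (hl : 0 ≤ l) (v : V) (R : ℝ) (x y : V) :
    |l * (min (dist v x) R - R) - l * (min (dist v y) R - R)| ≤ l * dist x y := by
  rw [← mul_sub, abs_mul, abs_of_nonneg hl, sub_sub_sub_cancel_right]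
  gcongr
  refine (abs_min_sub_min_le_max _ _ _ _).trans ?_
  rw [sub_self, abs_zero, max_eq_left (abs_nonneg _), dist_comm v x, dist_comm v y]
  exact abs_dist_sub_le x y v

/-- The weight `ξ = l (min (d(v, ·)) R - R)` is 0 beyond radius `R`, never positive, and at most `-l
(R - r)` inside radius `r`. At time `s` the mass beyond `r` is therefore counted with factor at most
1, and the rest with factor at most `e^{-l(R-r)}`. -/
theorem killedTail_le_step [MetricSpace V] (hθ : ∀ x, 0 < θ x) (hd : Γ.IsAdaptedMetric θ)
    (v : V) {l : ℝ} (hl0 : 0 ≤ l) (hl : l ≤ 1) {r R s t : ℝ} (hst : s ≤ t) :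
    Γ.killedTail θ B v R t ≤ Real.exp (l ^ 2 * (t - s)) *
      (Γ.killedTail θ B v r s +
        Real.exp (-(l * (R - r))) * (Γ.killedTransition θ B (s + s) v v / θ v)) := by
  classical
  set ξ : V → ℝ := fun x => l * (min (dist v x) R - R) with hξ
  refine (killedTail_le_energy hθ (ξ := ξ) fun x hx => ?_).trans
    ((killedEnergy_le_exp_mul hθ hd v hl (abs_mul_min_sub_le hl0 v R) hst).trans ?_)
  · simp [hξ, min_eq_right hx]
  · gcongr
    rw [← killedEnergy_zero hθ, killedTail, killedEnergy, killedEnergy, Finset.mul_sum,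
      Finset.sum_filter, ← Finset.sum_add_distrib]
    refine Finset.sum_le_sum fun x _ => ?_
    have h0 : 0 ≤ (Γ.killedTransition θ B s x v / θ v) ^ 2 * θ x :=
      mul_nonneg (sq_nonneg _) (hθ x).le
    rw [mul_right_comm, Real.exp_zero, mul_one]
    have hneg : ξ x ≤ 0 := mul_nonpos_of_nonneg_of_nonpos hl0 (by simp)
    split_ifs with h
    · have h1 := Real.exp_le_one_iff.2 hneg
      have h2 := Real.exp_pos (-(l * (R - r)))
      nlinarith [mul_nonneg h2.le h0]
    · have h1 : Real.exp (ξ x) ≤ Real.exp (-(l * (R - r))) := by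
        rw [Real.exp_le_exp]
        have : min (dist v x) R ≤ r := (min_le_left _ _).trans (not_le.1 h).le
        simp only [hξ]
        nlinarith
      nlinarith

/-- The same weight with the largest admissible slope `l = 1`, started at time 0, when all mass sits
at `v` and `ξ v = -R`. -/
theorem killedTail_le_exp [MetricSpace V] (hθ : ∀ x, 0 < θ x) (hd : Γ.IsAdaptedMetric θ)
    {v : V} (hv : v ∈ B) {R t : ℝ} (hR : 0 ≤ R) (ht : 0 ≤ t) :
    Γ.killedTail θ B v R t ≤ Real.exp (t - R) / θ v := by
  classical
  set ξ : V → ℝ := fun x => 1 * (min (dist v x) R - R) with hξ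
  refine (killedTail_le_energy hθ (ξ := ξ) fun x hx => ?_).trans
    ((killedEnergy_le_exp_mul hθ hd v le_rfl (abs_mul_min_sub_le zero_le_one v R) ht).trans ?_)
  · simp [hξ, min_eq_right hx]
  · rw [killedEnergy, Finset.sum_eq_single_of_mem v hv]
    · rw [killedTransition_zero hv, if_pos rfl, dist_self, min_eq_left hR, one_pow, one_mul,
        sub_zero, sub_eq_add_neg t R, Real.exp_add, one_mul, zero_sub]
      have := (hθ v).ne'
      apply le_of_eq
      field_simp
    · intro x hx hxv
      rw [killedTransition_zero hx, if_neg hxv]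
      simp

end WeightedGraph

/-! ### Grigor'yan's iteration. -/

/-- The budget for one iteration step, with `Z = β^{2k} X`. The energy cost is `ε² Z` and the
separation gain is `2εmZ = 4cZ`, since `c = εm/2`. Replacing `Z` by `β² Z` in the induction
hypothesis gains `c (β² - 1) Z`. Small `ε` and `b` and large `X₀` leave a spare `-1` in both
exponents. -/
theorem exists_iteration_constants {β : ℝ} (hβ : 1 < β) :
    ∃ m ε c b X₀ : ℝ, 4 * m = 1 - 1 / β ∧ 0 < ε ∧ ε * (4 * β ^ 4) ≤ 1 ∧ 0 < c ∧
      c * (4 * β ^ 4) ≤ 1 / 8 ∧ 0 < b ∧ 1 ≤ X₀ ∧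
      (∀ X Z, X₀ ≤ Z → X ≤ Z → ε ^ 2 * Z + (-(c * (β ^ 2 * Z)) + b * X) ≤ -(c * Z) + -1) ∧
      (∀ X Z, X₀ ≤ Z → X ≤ Z → ε ^ 2 * Z + (-(2 * ε * m * Z) + b * X) ≤ -(c * Z) + -1) := by
  have hβ0 : 0 < β := zero_lt_one.trans hβ
  obtain ⟨m, hm, hm0, hm4⟩ : ∃ m : ℝ, 4 * m = 1 - 1 / β ∧ 0 < m ∧ m ≤ 1 / 4 := by
    refine ⟨(1 - 1 / β) / 4, by ring, ?_, ?_⟩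
    · have : 1 / β < 1 := (div_lt_one hβ0).2 hβ
      linarith
    · have : 0 < 1 / β := by positivity
      linarith
  have hβ2 : 0 < β ^ 2 - 1 := by nlinarith
  obtain ⟨ε, hε0, hε1, hε2, hε3⟩ : ∃ ε : ℝ, 0 < ε ∧ ε ≤ m * (β ^ 2 - 1) / 8 ∧ ε ≤ m / 2 ∧
      ε ≤ 1 / (4 * β ^ 4) :=
    ⟨min (m * (β ^ 2 - 1) / 8) (min (m / 2) (1 / (4 * β ^ 4))), by positivity, min_le_left _ _,
      (min_le_right _ _).trans (min_le_left _ _), (min_le_right _ _).trans (min_le_right _ _)⟩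
  rw [le_div_iff₀ (by positivity)] at hε3
  obtain ⟨c, hc⟩ : ∃ c, c = ε * m / 2 := ⟨_, rfl⟩
  have hc0 : 0 < c := by rw [hc]; positivity
  obtain ⟨q, hq⟩ : ∃ q, q = c * (β ^ 2 - 1) := ⟨_, rfl⟩
  have hq0 : 0 < q := by rw [hq]; positivity
  obtain ⟨b, hb0, hb1, hb2⟩ : ∃ b : ℝ, 0 < b ∧ b ≤ c ∧ b ≤ q / 4 :=
    ⟨min c (q / 4), by positivity, min_le_left _ _, min_le_right _ _⟩
  obtain ⟨X₀, hX1, hX2, hX3⟩ : ∃ X₀ : ℝ, 1 ≤ X₀ ∧ 2 / q ≤ X₀ ∧ 1 / c ≤ X₀ :=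
    ⟨max 1 (max (2 / q) (1 / c)), le_max_left _ _, (le_max_left _ _).trans (le_max_right _ _),
      (le_max_right _ _).trans (le_max_right _ _)⟩
  refine ⟨m, ε, c, b, X₀, hm, hε0, hε3, hc0, ?_, hb0, hX1, fun X Z hZ hXZ => ?_,
    fun X Z hZ hXZ => ?_⟩
  · rw [hc]
    nlinarith
  · have h4 : ε ^ 2 ≤ q / 4 := by
      rw [hq, hc, sq]
      calc ε * ε ≤ ε * (m * (β ^ 2 - 1) / 8) := by gcongr
        _ = _ := by ring
    have h5 : 1 ≤ q / 2 * Z := by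
      have : 2 / q ≤ Z := hX2.trans hZ
      rw [div_le_iff₀ hq0] at this
      linarith
    have hZ0 : 0 ≤ Z := by linarith
    have h6 : ε ^ 2 * Z ≤ q / 4 * Z := by gcongr
    have h7 : b * X ≤ q / 4 * Z := by nlinarith
    have h8 : c * (β ^ 2 * Z) = q * Z + c * Z := by rw [hq]; ring
    linarith
  · have h4 : ε ^ 2 ≤ c := by
      rw [hc, sq]
      calc ε * ε ≤ ε * (m / 2) := by gcongr
        _ = _ := by ring
    have h5 : 1 ≤ c * Z := by
      have : 1 / c ≤ Z := hX3.trans hZ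
      rwa [div_le_iff₀ hc0, mul_comm] at this
    have hZ0 : 0 ≤ Z := by linarith
    have h6 : ε ^ 2 * Z ≤ c * Z := by gcongr
    have h7 : b * X ≤ c * Z := by nlinarith
    have h8 : 2 * ε * m * Z = 4 * (c * Z) := by rw [hc]; ring
    linarith

/-- The spare `-1` in each exponent yields `e⁻¹ ≤ 1/2`, so the two summands together reproduce the
bound with the same constant `M`; the constant does not grow along the iteration. -/
theorem exp_mul_add_le_of_exponents_le {D E Z c w a a' J P M F : ℝ} (hE : E ≤ D) (hM : 1 ≤ M)
    (hF : 0 ≤ F) {g : ℝ} (hJ : J ≤ M * (Real.exp a * Real.exp g) * F)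
    (hP : P ≤ Real.exp a' * Real.exp g * F)
    (h1 : D + a ≤ -(c * Z) + -1) (h2 : D + (-w + a') ≤ -(c * Z) + -1) :
    Real.exp E * (J + Real.exp (-w) * P) ≤ M * Real.exp (-(c * Z) + g) * F := by
  have hexp1 : Real.exp (-1) ≤ 1 / 2 := by
    rw [Real.exp_neg, ← one_div]
    exact one_div_le_one_div_of_le two_pos (by have := Real.add_one_le_exp 1; linarith)
  have hfin : ∀ E, E ≤ -(c * Z) + -1 → Real.exp E ≤ Real.exp (-(c * Z)) * (1 / 2) :=
    fun E hE => by
      calc Real.exp E ≤ Real.exp (-(c * Z) + -1) := Real.exp_le_exp.2 hE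
        _ = Real.exp (-(c * Z)) * Real.exp (-1) := Real.exp_add _ _
        _ ≤ _ := by gcongr
  have h1' := hfin _ h1
  have h2' := hfin _ h2
  have hM0 : 0 ≤ M := by linarith
  calc Real.exp E * (J + Real.exp (-w) * P)
      ≤ Real.exp E * (M * (Real.exp a * Real.exp g) * F +
          Real.exp (-w) * (Real.exp a' * Real.exp g * F)) := by gcongr
    _ ≤ Real.exp D * (M * (Real.exp a * Real.exp g) * F +
          Real.exp (-w) * (Real.exp a' * Real.exp g * F)) := by gcongr
    _ = (M * Real.exp (D + a) + 1 * Real.exp (D + (-w + a'))) * (Real.exp g * F) := by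
        simp only [Real.exp_add]; ring
    _ ≤ (M * (Real.exp (-(c * Z)) * (1 / 2)) + M * (Real.exp (-(c * Z)) * (1 / 2))) *
          (Real.exp g * F) := by gcongr
    _ = M * Real.exp (-(c * Z) + g) * F := by rw [Real.exp_add]; ring

/-- Grigor'yan's iteration: tails `I R t` that obey the one-step inequality `hstep` and the a priori
bound `hterm` inherit a Gaussian bound from bounds on the total mass `P` along a geometric sequence
of times. -/
theorem tail_le_of_iteration {β : ℝ} (hβ : 1 < β) :
    ∃ c > 0, ∃ b > 0, ∃ X₀ ≥ (1 : ℝ), ∀ (I : ℝ → ℝ → ℝ) (P : ℝ → ℝ) (K M F R s : ℝ),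
      (∀ l r R s t, 0 ≤ l → l ≤ 1 → 0 ≤ s → s ≤ t →
        I R t ≤ Real.exp (l ^ 2 * (t - s)) * (I r s + Real.exp (-(l * (R - r))) * P s)) →
      (∀ R t, 0 ≤ R → 0 ≤ t → I R t ≤ K * Real.exp (t - R)) →
      0 ≤ K → 1 ≤ M → 0 ≤ F → 0 < R → R ≤ s → X₀ ≤ R ^ 2 / s →
      (∀ k : ℕ, R / (4 * β ^ 4) ≤ s / (β ^ k) ^ 4 →
        P (s / (β ^ k) ^ 4) ≤ Real.exp (b * (R ^ 2 / s) * k) * F) →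
      K * Real.exp (-(R / 8)) ≤ M * F →
      I R s ≤ M * Real.exp (-(c * (R ^ 2 / s))) * F := by
  have hβ0 : 0 < β := zero_lt_one.trans hβ
  obtain ⟨m, ε, c, b, X₀, hm, hε0, hε3, hc0, hc4, hb0, hX1, hA1, hA2⟩ :=
    exists_iteration_constants hβ
  refine ⟨c, hc0, b, hb0, X₀, hX1, ?_⟩
  intro I P K M F R s hstep hterm hK hM hF hR hRs hX hP hKM
  have hs : 0 < s := hR.trans_le hRs
  obtain ⟨X, hXdef⟩ : ∃ X, X = R ^ 2 / s := ⟨_, rfl⟩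
  rw [← hXdef] at hX ⊢
  simp only [← hXdef] at hP
  have hX0 : 0 < X := by rw [hXdef]; positivity
  have hyk : ∀ k : ℕ, 1 ≤ β ^ k := fun k => one_le_pow₀ hβ.le
  -- Times shrink like `β^{-4k}` and the gaps between radii like `β^{-k}`, so squared gap over time
  -- grows like `β^{2k} X`.
  obtain ⟨sk, hsk⟩ : ∃ sk : ℕ → ℝ, ∀ k, sk k = s / (β ^ k) ^ 4 := ⟨_, fun _ => rfl⟩
  obtain ⟨Rk, hRk⟩ : ∃ Rk : ℕ → ℝ, ∀ k, Rk k = R / 2 * (1 + 1 / β ^ k) := ⟨_, fun _ => rfl⟩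
  simp only [← hsk] at hP
  have hsk0 : ∀ k, 0 < sk k := fun k => by
    have := hyk k
    rw [hsk]; positivity
  have hsucc : ∀ k, sk (k + 1) = sk k / β ^ 4 := fun k => by
    rw [hsk, hsk, pow_succ β k, mul_pow, div_div]
  have hskanti : ∀ k, sk (k + 1) ≤ sk k := fun k => by
    rw [hsucc]; exact div_le_self (hsk0 k).le (one_le_pow₀ hβ.le)
  -- The iteration stops at the first index whose time is below `R / 4`. By minimality every earlier
  -- time is at least `R / 4`, so time `N` is still at least `R / (4 β⁴)`.
  have hex : ∃ k, sk k < R / 4 := by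
    obtain ⟨k, hk⟩ := pow_unbounded_of_one_lt (4 * s / R) hβ
    refine ⟨k, ?_⟩
    rw [hsk, div_lt_div_iff₀ (by have := hyk k; positivity) (by norm_num)]
    rw [div_lt_iff₀ hR] at hk
    have h1 : β ^ k ≤ (β ^ k) ^ 4 := le_self_pow₀ (hyk k) (by norm_num)
    nlinarith
  classical
  obtain ⟨N, hN, hNmin⟩ : ∃ N, sk N < R / 4 ∧ ∀ k < N, R / 4 ≤ sk k :=
    ⟨Nat.find hex, Nat.find_spec hex, fun k hk => not_lt.1 (Nat.find_min hex hk)⟩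
  have hlow : ∀ k ≤ N, R / (4 * β ^ 4) ≤ sk k := by
    intro k hk
    have hβ4 : 1 ≤ β ^ 4 := one_le_pow₀ hβ.le
    rcases k with _ | k
    · rw [hsk, pow_zero, one_pow, div_one]
      exact (div_le_self hR.le (by linarith)).trans hRs
    · rw [hsucc, ← div_div]
      have := hNmin k hk
      gcongr
  -- Backward induction from `N` to 0. The term `b X k` collects the growth of the on-diagonal
  -- values and vanishes at `k = 0`.
  have key : ∀ j k, k + j = N →
      I (Rk k) (sk k) ≤ M * Real.exp (-(c * ((β ^ k) ^ 2 * X)) + b * X * k) * F := by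
    intro j
    induction j with
    | zero =>
      intro k hk
      obtain rfl : k = N := hk
      have hy := hyk k
      have hRk2 : R / 2 ≤ Rk k := by
        rw [hRk]
        have : 0 < 1 / β ^ k := by positivity
        nlinarith
      have h1 := hterm (Rk k) (sk k) (by linarith) (hsk0 k).le
      have h5 : (β ^ k) ^ 4 * X = R ^ 2 / sk k := by
        rw [hsk, hXdef]
        field_simp
      generalize β ^ k = y at *
      have h2 : c * (y ^ 2 * X) ≤ R / 8 := by
        have h4 := hlow k le_rfl
        rw [div_le_iff₀ (by positivity)] at h4
        have h6 : y ^ 2 * X ≤ y ^ 4 * X :=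
          mul_le_mul_of_nonneg_right (pow_le_pow_right₀ hy (by norm_num)) hX0.le
        have h3 : R ^ 2 / sk k ≤ R * (4 * β ^ 4) := by
          rw [div_le_iff₀ (hsk0 k), sq, mul_assoc, mul_comm (4 * β ^ 4)]
          gcongr
        calc c * (y ^ 2 * X) ≤ c * (R * (4 * β ^ 4)) :=
              mul_le_mul_of_nonneg_left (h6.trans (h5.trans_le h3)) hc0.le
          _ = R * (c * (4 * β ^ 4)) := by ring
          _ ≤ R * (1 / 8) := by gcongr
          _ = R / 8 := by ring
      have hbX : 0 ≤ b * X * k := by positivity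
      -- Here `sk k < R / 4` and `Rk k ≥ R / 2` leave `e^{-R/4}`: one half pays for `K`, the other
      -- for the exponent in `h2`.
      calc I (Rk k) (sk k) ≤ K * Real.exp (sk k - Rk k) := h1
        _ ≤ K * Real.exp (-(R / 8) + -(R / 8)) := by gcongr; linarith
        _ = K * Real.exp (-(R / 8)) * Real.exp (-(R / 8)) := by rw [Real.exp_add]; ring
        _ ≤ M * F * Real.exp (-(c * (y ^ 2 * X)) + b * X * k) := by
          gcongr
          linarith
        _ = _ := by ring
    | succ j ih =>
      intro k hk
      have h1 := ih (k + 1) (by omega)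
      have h2 := hP (k + 1) (hlow (k + 1) (by omega))
      have hlowk := hlow k (by omega)
      have hy := hyk k
      have hysucc : β ^ (k + 1) = β ^ k * β := pow_succ β k
      have hskk := hsk k
      have hRkk : Rk k - Rk (k + 1) = R / 2 * (4 * m) / β ^ k := by
        rw [hRk, hRk, hysucc, hm]
        field_simp
        ring
      rw [hysucc] at h1
      generalize β ^ k = y at *
      obtain ⟨Z, hZdef⟩ : ∃ Z, Z = y ^ 2 * X := ⟨_, rfl⟩
      have hXZ : X ≤ Z := by
        rw [hZdef]; exact le_mul_of_one_le_left hX0.le (one_le_pow₀ hy)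
      have hZ : X₀ ≤ Z := hX.trans hXZ
      have hy0 : 0 < y := by linarith
      -- This slope makes both the energy cost and the separation gain multiples of `Z`; it is at
      -- most 1 because `sk k` is at least `R / (4 β⁴)`.
      obtain ⟨l, hl⟩ : ∃ l, l = ε * R * y ^ 3 / s := ⟨_, rfl⟩
      have hl0 : 0 ≤ l := by rw [hl]; positivity
      have hly : l * y = ε * (R / sk k) := by
        rw [hl, hskk]; field_simp
      have hRsk : R / sk k ≤ 4 * β ^ 4 := by
        rw [div_le_iff₀ (hsk0 k)]
        rw [div_le_iff₀ (by positivity)] at hlowk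
        linarith
      have hl1 : l ≤ 1 :=
        calc l ≤ l * y := le_mul_of_one_le_right hl0 hy
          _ = ε * (R / sk k) := hly
          _ ≤ ε * (4 * β ^ 4) := by gcongr
          _ ≤ 1 := hε3
      have hE1 : l ^ 2 * (sk k - sk (k + 1)) ≤ ε ^ 2 * Z := by
        have h3 : l ^ 2 * sk k = ε ^ 2 * Z := by
          rw [hl, hskk, hZdef, hXdef]; field_simp
        have := mul_nonneg (sq_nonneg l) (hsk0 (k + 1)).le
        linarith
      have hE2 : l * (Rk k - Rk (k + 1)) = 2 * ε * m * Z := by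
        rw [hRkk, hl, hZdef, hXdef]; field_simp; ring
      have h3 := hstep l (Rk (k + 1)) (Rk k) (sk (k + 1)) (sk k) hl0 hl1 (hsk0 _).le (hskanti k)
      rw [hE2] at h3
      have e1 : -(c * ((y * β) ^ 2 * X)) + b * X * (k + 1 : ℕ) =
          (-(c * (β ^ 2 * Z)) + b * X) + b * X * k := by
        rw [hZdef]; push_cast; ring
      have e2 : b * X * (k + 1 : ℕ) = b * X + b * X * k := by push_cast; ring
      rw [e1, Real.exp_add] at h1
      rw [e2, Real.exp_add] at h2
      rw [← hZdef]
      exact h3.trans (exp_mul_add_le_of_exponents_le hE1 hM hF h1 h2 (hA1 X Z hZ hXZ)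
        (hA2 X Z hZ hXZ))
  have h := key N 0 (zero_add N)
  rw [hRk, hsk, show R / 2 * (1 + 1 / β ^ 0) = R by rw [pow_zero]; ring] at h
  simpa using h

/-! ### Growth of regular functions along geometric sequences. -/

theorem IsRegularOn.div_mem {A γ a t : ℝ} {b : EReal} {g : ℝ → ℝ} (h : IsRegularOn A γ a b g)
    (hat : γ * a < t) (htb : (t : EReal) < b) : t / γ ∈ timeInterval a b := by
  have hγ := h.one_lt
  have hγ0 : 0 < γ := by linarith
  have h0 := h.nonneg
  have ht : 0 < t := lt_of_le_of_lt (by positivity) hat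
  refine ⟨(lt_div_iff₀ hγ0).2 (by linarith), lt_of_le_of_lt ?_ htb⟩
  exact_mod_cast div_le_self ht.le hγ.le

/-- Telescoping: by regularity, each ratio of `g` over one factor `γ` at an earlier time is at most
`A` times the last ratio `g t / g (t / γ)`. -/
theorem IsRegularOn.le_pow_mul {A γ a t : ℝ} {b : EReal} {g : ℝ → ℝ} (h : IsRegularOn A γ a b g)
    (hat : γ * a < t) (htb : (t : EReal) < b) (k : ℕ) (hk : a < t / γ ^ k) :
    g t ≤ (A * (g t / g (t / γ))) ^ k * g (t / γ ^ k) := by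
  have hγ := h.one_lt
  have hγ0 : 0 < γ := by linarith
  have h0 := h.nonneg
  have ht : 0 < t := lt_of_le_of_lt (by positivity) hat
  have hmem : ∀ j : ℕ, a < t / γ ^ j → t / γ ^ j ∈ timeInterval a b := fun j hj => by
    refine ⟨hj, lt_of_le_of_lt ?_ htb⟩
    exact_mod_cast div_le_self ht.le (one_le_pow₀ hγ.le)
  have hA0 : 0 < A := by linarith [h.one_le]
  have hgt := h.pos _ (by simpa using hmem 0 (by rw [pow_zero, div_one]; nlinarith) : t ∈ _)
  have hgγ := h.pos _ (h.div_mem hat htb)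
  have hQ : 0 < g t / g (t / γ) := div_pos hgt hgγ
  induction k with
  | zero => simp
  | succ k ih =>
    have hle : t / γ ^ (k + 1) ≤ t / γ ^ k := by
      gcongr
      · exact hγ.le
      · omega
    have h1 := ih (hk.trans_le hle)
    have hgk := h.pos _ (hmem (k + 1) hk)
    have hstep : g (t / γ ^ k) ≤ A * (g t / g (t / γ)) * g (t / γ ^ (k + 1)) := by
      -- Regularity compares strictly ordered times only, so the last ratio is compared with itself
      -- through `1 ≤ A`.
      rcases Nat.eq_zero_or_pos k with rfl | hkpos
      · rw [zero_add, pow_one, pow_zero, div_one, mul_assoc, div_mul_cancel₀ _ hgγ.ne']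
        exact le_mul_of_one_le_left hgt.le h.one_le
      · have hlt : t / γ ^ (k + 1) < t / γ := by
          gcongr
          exact lt_self_pow₀ hγ (by omega)
        have h2 := h.ratio_le _ _ hk hlt (by rwa [mul_div_cancel₀ _ hγ0.ne'])
        rw [mul_div_cancel₀ _ hγ0.ne', show γ * (t / γ ^ (k + 1)) = t / γ ^ k by
          rw [pow_succ]; field_simp, div_le_iff₀ hgk] at h2
        exact h2
    calc g t ≤ _ := h1
      _ ≤ (A * (g t / g (t / γ))) ^ k * (A * (g t / g (t / γ)) * g (t / γ ^ (k + 1))) := by gcongr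
      _ = _ := by ring

/-! ### Gaussian tail bound and off-diagonal bound for the killed walk. -/

namespace WeightedGraph

/-- Gaussian tail bound: an on-diagonal bound by a regular function `1 / f` controls the mass of
`p_{t/2}(·, v)²` at distance at least `R` from `v`. -/
theorem killedTail_le_gaussian {γ : ℝ} (hγ : 1 < γ) :
    ∃ c > 0, ∀ A Cθ : ℝ, 1 ≤ A → 0 < Cθ → ∃ C ≥ 1, ∀ {V : Type*} [MetricSpace V]
      {Γ : WeightedGraph V} {θ : V → ℝ} {B : Finset V} {v : V} {T₁ : ℝ} {T₂ : EReal} {f : ℝ → ℝ},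
      (∀ x, Cθ ≤ θ x) → Γ.IsAdaptedMetric θ → v ∈ B → IsRegularOn A γ T₁ T₂ f →
      (∀ t ∈ timeInterval T₁ T₂, f t ≤ A * Real.exp (√t)) →
      (∀ t ∈ timeInterval T₁ T₂, Γ.killedTransition θ B t v v / θ v ≤ 1 / f t) →
      ∀ R t : ℝ, (2 * γ) ^ 2 * T₁ ^ 2 < t → γ * T₁ < t → (t : EReal) < T₂ → 0 ≤ R → R ≤ t / 2 →
        Γ.killedTail θ B v R (t / 2) ≤ C * Real.exp (-(c * (R ^ 2 / t))) / f (t / γ) := by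
  -- With `β = γ^{1/4}`, twice the `k`-th time of the iteration started at `t / 2` is exactly `t / γ
  -- ^ k`.
  obtain ⟨β, hβ, rfl⟩ : ∃ β : ℝ, 1 < β ∧ β ^ 4 = γ := by
    refine ⟨γ ^ (1 / 4 : ℝ), Real.one_lt_rpow hγ (by norm_num), ?_⟩
    rw [← Real.rpow_natCast, ← Real.rpow_mul (by linarith)]
    norm_num
  obtain ⟨c, hc, b, hb, X₀, hX₀, H⟩ := tail_le_of_iteration hβ
  refine ⟨min c b, lt_min hc hb, fun A Cθ hA hCθ => ?_⟩
  set X₁ := max X₀ 128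
  -- One entry for each regime: bounded `X`, fast growth of `f`, and the iteration.
  set C := max (Real.exp (c * X₁)) (max A (max 1 (A / Cθ))) with hC
  have hC1 : 1 ≤ C := (le_max_left _ _).trans ((le_max_right _ _).trans (le_max_right _ _))
  refine ⟨C, hC1, ?_⟩
  intro V _ Γ θ B v T₁ T₂ f hθC hd hv hf hexp hdiag R t htT htγ htT₂ hR hRt
  set γ := β ^ 4
  have hγ0 : 0 < γ := by linarith
  have hT₁ := hf.nonneg
  have ht : 0 < t := lt_of_le_of_lt (by positivity) htγ
  have hθ : ∀ x, 0 < θ x := fun x => hCθ.trans_le (hθC x)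
  have hmemt : t ∈ timeInterval T₁ T₂ := ⟨by nlinarith, htT₂⟩
  have hmemγ := hf.div_mem htγ htT₂
  have hft := hf.pos _ hmemt
  have hfγ := hf.pos _ hmemγ
  have hmono : f (t / γ) ≤ f t := hf.monotoneOn hmemγ hmemt (div_le_self ht.le hγ.le)
  have htriv : Γ.killedTail θ B v R (t / 2) ≤ 1 / f t :=
    (killedTail_le_killedTransition hθ v R _).trans (by rw [add_halves]; exact hdiag t hmemt)
  obtain ⟨X, hX⟩ : ∃ X, X = R ^ 2 / (t / 2) := ⟨_, rfl⟩
  have hX0 : 0 ≤ X := by rw [hX]; positivity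
  have hXle : R ^ 2 / t ≤ X := by
    rw [hX]
    gcongr
    linarith
  rcases lt_or_ge X X₁ with hsmall | hlarge
  · calc _ ≤ 1 / f t := htriv
      _ ≤ 1 / f (t / γ) := one_div_le_one_div_of_le hfγ hmono
      _ ≤ C * Real.exp (-(c * X)) / f (t / γ) := by
        gcongr
        calc (1 : ℝ) = Real.exp (c * X) * Real.exp (-(c * X)) := by
              rw [← Real.exp_add, add_neg_cancel, Real.exp_zero]
          _ ≤ Real.exp (c * X₁) * Real.exp (-(c * X)) := by gcongr
          _ ≤ _ := by gcongr; exact le_max_left _ _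
      _ ≤ _ := by gcongr; exact min_le_left _ _
  obtain ⟨Q, hQ⟩ : ∃ Q, Q = f t / f (t / γ) := ⟨_, rfl⟩
  have hQ0 : 0 < Q := by rw [hQ]; positivity
  -- Either `f` grows so fast from `t / γ` to `t` that `1 / f t` already carries the Gaussian
  -- factor, or `A Q` is small enough for the iteration.
  rcases lt_or_ge (Real.exp (b * X)) (A * Q) with hbig | hdoubling
  · calc _ ≤ 1 / f t := htriv
      _ ≤ A * Real.exp (-(b * X)) / f (t / γ) := by
        rw [hQ, ← mul_div_assoc, lt_div_iff₀ hfγ] at hbig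
        rw [Real.exp_neg, div_le_div_iff₀ hft hfγ, one_mul, mul_right_comm, ← div_eq_mul_inv,
          le_div_iff₀ (Real.exp_pos _), mul_comm]
        exact hbig.le
      _ ≤ C * Real.exp (-(min c b * (R ^ 2 / t))) / f (t / γ) := by
        gcongr
        · exact (le_max_left _ _).trans (le_max_right _ _)
        · exact min_le_right _ _
  · have hX128 : 128 ≤ X := (le_max_right _ _).trans hlarge
    -- The threshold 128 serves two ends: `√t ≤ R / 8`, so that `f t ≤ A e^{R/8}`, and `2γT₁ < R`,
    -- so that all times used by the iteration stay above `T₁`.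
    have hRsq : 64 * t ≤ R ^ 2 := by
      rw [hX, le_div_iff₀ (by positivity)] at hX128
      linarith
    have hR0 : 0 < R := by
      rcases hR.eq_or_lt with h | h
      · rw [← h] at hRsq; nlinarith
      · exact h
    have hRT : 2 * γ * T₁ < R := by
      refine lt_of_pow_lt_pow_left₀ 2 hR ?_
      rw [mul_pow]
      linarith
    have hM1 : 1 ≤ max 1 (A / Cθ) := le_max_left _ _
    have hsq : √t ≤ R / 8 := by
      rw [Real.sqrt_le_left (by positivity)]
      nlinarith
    have hlow : ∀ k : ℕ, R / (4 * γ) ≤ t / 2 / (β ^ k) ^ 4 → T₁ < t / γ ^ k := fun k hk => by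
      rw [← pow_mul, mul_comm k, pow_mul, div_right_comm, div_le_iff₀ (by positivity)] at hk
      have : T₁ < R / (4 * γ) * 2 := by
        rw [div_mul_eq_mul_div, lt_div_iff₀ (by positivity)]
        linarith
      have h2 : 2 * (t / γ ^ k / 2) = t / γ ^ k := by ring
      nlinarith
    have := H (Γ.killedTail θ B v) (fun s => Γ.killedTransition θ B (s + s) v v / θ v)
      (1 / θ v) (max 1 (A / Cθ)) (1 / f t) R (t / 2)
      (fun l r R s t hl0 hl _ hst => killedTail_le_step hθ hd v hl0 hl hst)
      (fun R t hR ht => (killedTail_le_exp hθ hd hv hR ht).trans_eq (by ring))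
      (by have := hθ v; positivity) hM1 (by positivity) hR0 hRt
      (by rw [← hX]; exact (le_max_left _ _).trans hlarge)
      (fun k hk => ?_) ?_
    · rw [← hX] at this
      calc _ ≤ _ := this
        _ = max 1 (A / Cθ) * Real.exp (-(c * X)) / f t := by ring
        _ ≤ C * Real.exp (-(min c b * (R ^ 2 / t))) / f (t / γ) := by
          gcongr
          · exact (le_max_right _ _).trans (le_max_right _ _)
          · exact min_le_left _ _
    · have hk' := hlow k hk
      have hmemk : t / γ ^ k ∈ timeInterval T₁ T₂ := by
        refine ⟨hk', lt_of_le_of_lt ?_ htT₂⟩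
        exact_mod_cast div_le_self ht.le (one_le_pow₀ hγ.le)
      have hfk := hf.pos _ hmemk
      have h1 := hf.le_pow_mul htγ htT₂ k hk'
      rw [← hQ] at h1
      have h2 : (A * Q) ^ k ≤ Real.exp (b * X * k) := by
        rw [mul_comm _ (k : ℝ), Real.exp_nat_mul]
        gcongr
      have e1 : t / 2 / (β ^ k) ^ 4 + t / 2 / (β ^ k) ^ 4 = t / γ ^ k := by
        rw [← pow_mul, mul_comm k, pow_mul]; ring
      simp only [e1, ← hX]
      refine (hdiag _ hmemk).trans ?_
      rw [mul_one_div, div_le_div_iff₀ hfk hft, one_mul]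
      exact h1.trans (by gcongr)
    · have h1 : f t ≤ A * Real.exp (R / 8) := (hexp t hmemt).trans (by gcongr)
      calc 1 / θ v * Real.exp (-(R / 8)) ≤ 1 / Cθ * Real.exp (-(R / 8)) := by
            gcongr; exact hθC v
        _ ≤ A / Cθ * (1 / f t) := by
            rw [Real.exp_neg, div_mul_div_comm, ← one_div, div_mul_div_comm, mul_one, mul_one,
              div_le_div_iff₀ (by positivity) (by positivity)]
            nlinarith
        _ ≤ _ := by gcongr; exact le_max_right _ _

/-- Off-diagonal bound for the killed heat kernel through the tails of the two halves. -/
theorem killedTransition_le_sqrt_add_sqrt [MetricSpace V] {Γ : WeightedGraph V} {θ : V → ℝ}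
    {B : Finset V} (hθ : ∀ x, 0 < θ x) (v₁ v₂ : V) (s : ℝ) :
    Γ.killedTransition θ B (s + s) v₁ v₂ / θ v₂ ≤
      √(Γ.killedTail θ B v₁ (dist v₁ v₂ / 2) s) *
        √(Γ.killedTransition θ B (s + s) v₂ v₂ / θ v₂) +
      √(Γ.killedTail θ B v₂ (dist v₁ v₂ / 2) s) *
        √(Γ.killedTransition θ B (s + s) v₁ v₁ / θ v₁) := by
  classical
  set u : V → V → ℝ := fun v x => Γ.killedTransition θ B s x v / θ v with hu
  set R := dist v₁ v₂ / 2 with hR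
  have hdiag : ∀ v, Γ.killedTransition θ B (s + s) v v / θ v = ∑ x ∈ B, u v x ^ 2 * θ x := fun v => by
    rw [← killedEnergy_zero hθ, killedEnergy]
    simp [hu]
  have hsum : Γ.killedTransition θ B (s + s) v₁ v₂ / θ v₂ = ∑ x ∈ B, u v₁ x * u v₂ x * θ x := by
    rw [killedTransition_add, Finset.sum_div]
    refine Finset.sum_congr rfl fun x _ => ?_
    have h := killedTransition_symm (Γ := Γ) (B := B) hθ s v₁ x
    have h2 : Γ.killedTransition θ B s v₁ x = θ x * Γ.killedTransition θ B s x v₁ / θ v₁ := by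
      rw [← h, mul_div_cancel_left₀ _ (hθ v₁).ne']
    rw [h2]
    simp only [hu]
    ring
  have hcs : ∀ (S : Finset V) (v w : V), ∑ x ∈ S, |u v x| * |u w x| * θ x ≤
      √(∑ x ∈ S, u v x ^ 2 * θ x) * √(∑ x ∈ S, u w x ^ 2 * θ x) := fun S v w => by
    have h := Real.sum_mul_le_sqrt_mul_sqrt S (fun x => |u v x| * √(θ x)) fun x => |u w x| * √(θ x)
    simp only [mul_pow, sq_abs, Real.sq_sqrt (hθ _).le] at h
    refine le_trans (le_of_eq (Finset.sum_congr rfl fun x _ => ?_)) h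
    rw [mul_mul_mul_comm, Real.mul_self_sqrt (hθ x).le]
  have hfull : ∀ v w, ∑ x ∈ B with R ≤ dist v x, |u v x| * |u w x| * θ x ≤
      √(Γ.killedTail θ B v R s) * √(Γ.killedTransition θ B (s + s) w w / θ w) := fun v w => by
    refine (hcs _ v w).trans ?_
    rw [hdiag, killedTail]
    gcongr
    · exact fun x _ _ => mul_nonneg (sq_nonneg _) (hθ x).le
    · exact Finset.filter_subset _ _
  rw [hsum]
  -- By the triangle inequality each `x` lies at distance at least `R` from `v₁` or from `v₂`.
  calc ∑ x ∈ B, u v₁ x * u v₂ x * θ x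
      ≤ ∑ x ∈ B, ((if R ≤ dist v₁ x then |u v₁ x| * |u v₂ x| * θ x else 0) +
          if R ≤ dist v₂ x then |u v₂ x| * |u v₁ x| * θ x else 0) := by
        refine Finset.sum_le_sum fun x _ => ?_
        have h0 : 0 ≤ |u v₁ x| * |u v₂ x| * θ x := by have := (hθ x).le; positivity
        have h1 : u v₁ x * u v₂ x * θ x ≤ |u v₁ x| * |u v₂ x| * θ x := by
          rw [← abs_mul]
          exact mul_le_mul_of_nonneg_right (le_abs_self _) (hθ x).le
        rw [mul_comm |u v₂ x|]
        by_cases h2 : R ≤ dist v₁ x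
        · rw [if_pos h2]
          split_ifs <;> linarith
        · have h3 : R ≤ dist v₂ x := by
            have := dist_triangle_right v₁ v₂ x
            rw [not_le] at h2
            linarith
          rw [if_neg h2, if_pos h3, zero_add]
          exact h1
    _ ≤ _ := by
        rw [Finset.sum_add_distrib, ← Finset.sum_filter, ← Finset.sum_filter]
        exact add_le_add (hfull v₁ v₂) (hfull v₂ v₁)

end WeightedGraph

/-! ### Head and tail of an i.i.d. sequence; exponential waiting times. -/

namespace MeasureTheory.Measure

/-- The product measure is determined on boxes. Padding a box with full factors up to an initial
segment of `ℕ` lets it split into its zeroth side and a shifted box. -/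
theorem infinitePi_nat_eq_map_cons {X : Type*} [MeasurableSpace X] (ν : Measure X)
    [IsProbabilityMeasure ν] :
    infinitePi (fun _ : ℕ => ν) = (ν.prod (infinitePi fun _ : ℕ => ν)).map
      (fun p n => Nat.casesOn n p.1 p.2) := by
  classical
  have hmeas : Measurable fun (p : X × (ℕ → X)) (n : ℕ) => (Nat.casesOn n p.1 p.2 : X) := by
    refine measurable_pi_lambda _ fun n => ?_
    cases n with
    | zero => exact measurable_fst
    | succ n => exact (measurable_pi_apply n).comp measurable_snd
  refine (eq_infinitePi _ fun s t ht => ?_).symm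
  obtain ⟨m, hm⟩ : ∃ m, s ⊆ Finset.range (m + 1) := by
    obtain ⟨m, hm⟩ := s.exists_nat_subset_range
    exact ⟨m, hm.trans (Finset.range_mono (Nat.le_succ m))⟩
  set t' : ℕ → Set X := fun i => if i ∈ s then t i else Set.univ with ht'
  have ht'm : ∀ i, MeasurableSet (t' i) := fun i => by
    simp only [ht']; split_ifs; exacts [ht i, .univ]
  have hset : Set.pi (s : Set ℕ) t = Set.pi (Finset.range (m + 1) : Set ℕ) t' := by
    ext f
    simp only [Set.mem_pi, ht', Finset.mem_coe]
    refine ⟨fun h i _ => ?_, fun h i hi => ?_⟩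
    · split_ifs with his
      · exact h i his
      · trivial
    · simpa [hi] using h i (hm hi)
  have hprod : ∏ i ∈ s, ν (t i) = ∏ i ∈ Finset.range (m + 1), ν (t' i) := by
    rw [← Finset.prod_subset hm]
    · exact Finset.prod_congr rfl fun i hi => by simp [ht', hi]
    · intro i _ hi
      simp [ht', hi]
  rw [hprod, hset, map_apply hmeas (MeasurableSet.pi (Finset.countable_toSet _) fun i _ => ht'm i)]
  have hpre : (fun (p : X × (ℕ → X)) (n : ℕ) => (Nat.casesOn n p.1 p.2 : X)) ⁻¹'
      Set.pi (Finset.range (m + 1) : Set ℕ) t' =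
      t' 0 ×ˢ Set.pi (Finset.range m : Set ℕ) fun i => t' (i + 1) := by
    ext p
    simp only [Set.mem_preimage, Set.mem_pi, Finset.coe_range, Set.mem_Iio, Set.mem_prod]
    refine ⟨fun h => ⟨h 0 (Nat.succ_pos m), fun i hi => h (i + 1) (by omega)⟩, fun h i hi => ?_⟩
    cases i with
    | zero => exact h.1
    | succ i => exact h.2 i (by omega)
  rw [hpre, prod_prod, infinitePi_pi _ fun i _ => ht'm (i + 1), Finset.prod_range_succ', mul_comm]

theorem infinitePi_nat_map_head_tail {X : Type*} [MeasurableSpace X] (ν : Measure X)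
    [IsProbabilityMeasure ν] :
    (infinitePi fun _ : ℕ => ν).map (fun ω => (ω 0, fun n => ω (n + 1))) =
      ν.prod (infinitePi fun _ : ℕ => ν) := by
  have hmeas : Measurable fun (p : X × (ℕ → X)) (n : ℕ) => (Nat.casesOn n p.1 p.2 : X) := by
    refine measurable_pi_lambda _ fun n => ?_
    cases n with
    | zero => exact measurable_fst
    | succ n => exact (measurable_pi_apply n).comp measurable_snd
  rw [infinitePi_nat_eq_map_cons, map_map (by fun_prop) hmeas, ← infinitePi_nat_eq_map_cons]
  exact map_id

end MeasureTheory.Measure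

namespace ProbabilityTheory

theorem expMeasure_Iic {r : ℝ} (hr : 0 < r) {t : ℝ} (ht : 0 ≤ t) :
    expMeasure r (Set.Iic t) = ENNReal.ofReal (1 - Real.exp (-(r * t))) := by
  have := isProbabilityMeasure_expMeasure hr
  rw [← ofReal_cdf, cdf_expMeasure_eq hr, if_pos ht]

theorem expMeasure_Ioi {r : ℝ} (hr : 0 < r) {t : ℝ} (ht : 0 ≤ t) :
    expMeasure r (Set.Ioi t) = ENNReal.ofReal (Real.exp (-(r * t))) := by
  have := isProbabilityMeasure_expMeasure hr
  have hle : Real.exp (-(r * t)) ≤ 1 := by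
    rw [Real.exp_le_one_iff]
    have := mul_nonneg hr.le ht
    linarith
  rw [← Set.compl_Iic, prob_compl_eq_one_sub measurableSet_Iic, expMeasure_Iic hr ht,
    ← ENNReal.ofReal_one, ← ENNReal.ofReal_sub _ (by linarith), sub_sub_cancel]

theorem ae_expMeasure_pos {r : ℝ} (hr : 0 < r) : ∀ᵐ s ∂expMeasure r, 0 < s := by
  rw [ae_iff]
  have : {s : ℝ | ¬0 < s} = Set.Iic 0 := by ext s; simp
  rw [this, expMeasure_Iic hr le_rfl]
  simp

theorem setLIntegral_Iic_expMeasure {r : ℝ} (hr : 0 < r) {t : ℝ} (ht : 0 ≤ t) {g : ℝ → ℝ}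
    (hg : Continuous g) (hg0 : ∀ s ∈ Set.Icc 0 t, 0 ≤ g s) :
    ∫⁻ s in Set.Iic t, ENNReal.ofReal (g s) ∂expMeasure r =
      ENNReal.ofReal (∫ s in 0..t, r * Real.exp (-(r * s)) * g s) := by
  have hpdf : Measurable (exponentialPDF r) := (measurable_exponentialPDFReal r).ennreal_ofReal
  have hdens : expMeasure r = volume.withDensity (exponentialPDF r) := rfl
  rw [hdens, setLIntegral_withDensity_eq_setLIntegral_mul _ hpdf
    hg.measurable.ennreal_ofReal measurableSet_Iic, lintegral_Iic_eq_lintegral_Iio_add_Icc _ ht]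
  have h1 : ∫⁻ s in Set.Iio 0, (exponentialPDF r * fun s => ENNReal.ofReal (g s)) s = 0 := by
    rw [setLIntegral_congr_fun measurableSet_Iio (g := fun _ => 0), lintegral_zero]
    intro s hs
    simp [exponentialPDF_of_neg hs]
  have h2 : ∫⁻ s in Set.Icc 0 t, (exponentialPDF r * fun s => ENNReal.ofReal (g s)) s =
      ∫⁻ s in Set.Icc 0 t, ENNReal.ofReal (r * Real.exp (-(r * s)) * g s) := by
    refine setLIntegral_congr_fun measurableSet_Icc fun s hs => ?_
    simp only [Pi.mul_apply]
    rw [exponentialPDF_of_nonneg hs.1, ← ENNReal.ofReal_mul (by positivity)]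
  have hcont : Continuous fun s => r * Real.exp (-(r * s)) * g s := by fun_prop
  rw [h1, zero_add, h2, intervalIntegral.integral_of_le ht, ← integral_Icc_eq_integral_Ioc,
    ofReal_integral_eq_lintegral_ofReal (hcont.integrableOn_Icc)]
  filter_upwards [ae_restrict_mem measurableSet_Icc] with s hs
  have := hg0 s hs
  positivity

end ProbabilityTheory

/-! ### First-jump decomposition of paths, and measurability. -/

namespace RandomWalk

variable {V : Type*}

/-- Instructions are indexed by the step number, so the shifted sequence drives the walk restarted
at the first vertex it jumps to. -/
theorem chain_succ_eq (x : V) (ω : ℕ → V → V × ℝ) (n : ℕ) :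
    chain x ω (n + 1) = chain (ω 0 x).1 (fun n => ω (n + 1)) n := by
  induction n with
  | zero => rfl
  | succ n ih =>
    rw [chain, ih]
    rfl

theorem arrivalTime_zero (x : V) (ω : ℕ → V → V × ℝ) : arrivalTime x ω 0 = 0 := by
  simp [arrivalTime]

theorem arrivalTime_succ_eq (x : V) (ω : ℕ → V → V × ℝ) (n : ℕ) :
    arrivalTime x ω (n + 1) =
      (ω 0 x).2 + arrivalTime (ω 0 x).1 (fun n => ω (n + 1)) n := by
  rw [arrivalTime, Finset.sum_range_succ', add_comm]
  simp only [chain_succ_eq]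
  rfl

/-- The event that the walk started at `x` is at `y` at time `t` after at most `N` jumps. -/
def atEventWithin (N : ℕ) (x : V) (t : ℝ) (y : V) : Set (ℕ → V → V × ℝ) :=
  {ω | ∃ n ≤ N, arrivalTime x ω n ≤ t ∧ t < arrivalTime x ω (n + 1) ∧ chain x ω n = y}

theorem atEvent_eq_iUnion (x : V) (t : ℝ) (y : V) :
    atEvent x t y = ⋃ N, atEventWithin N x t y := by
  ext ω
  simp only [atEvent, atEventWithin, Set.mem_iUnion, Set.mem_ofPred_eq]
  exact ⟨fun ⟨n, h⟩ => ⟨n, n, le_rfl, h⟩, fun ⟨_, n, _, h⟩ => ⟨n, h⟩⟩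

theorem atEventWithin_mono (x : V) (t : ℝ) (y : V) : Monotone fun N => atEventWithin N x t y :=
  fun _ _ h _ ⟨n, hn, hω⟩ => ⟨n, hn.trans h, hω⟩

theorem mem_atEventWithin_zero {x : V} {t : ℝ} {y : V} {ω : ℕ → V → V × ℝ} :
    ω ∈ atEventWithin 0 x t y ↔ 0 ≤ t ∧ t < (ω 0 x).2 ∧ x = y := by
  simp [atEventWithin, arrivalTime_succ_eq, arrivalTime_zero, chain]

theorem mem_atEventWithin_succ {N : ℕ} {x : V} {t : ℝ} {y : V} {ω : ℕ → V → V × ℝ} :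
    ω ∈ atEventWithin (N + 1) x t y ↔ (0 ≤ t ∧ t < (ω 0 x).2 ∧ x = y) ∨
      (fun n => ω (n + 1)) ∈ atEventWithin N (ω 0 x).1 (t - (ω 0 x).2) y := by
  rw [← mem_atEventWithin_zero]
  simp only [atEventWithin, Set.mem_ofPred_eq]
  constructor
  · rintro ⟨n, hn, h1, h2, h3⟩
    rcases n with _ | n
    · exact Or.inl ⟨0, le_rfl, h1, h2, h3⟩
    · rw [arrivalTime_succ_eq] at h1 h2
      rw [chain_succ_eq] at h3
      exact Or.inr ⟨n, by omega, by linarith, by linarith, h3⟩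
  · rintro (⟨n, hn, h⟩ | ⟨n, hn, h1, h2, h3⟩)
    · exact ⟨n, by omega, h⟩
    · refine ⟨n + 1, by omega, ?_, ?_, ?_⟩
      · rw [arrivalTime_succ_eq]; linarith
      · rw [arrivalTime_succ_eq]; linarith
      · rw [chain_succ_eq]; exact h3

variable [Countable V] [MeasurableSpace V] [DiscreteMeasurableSpace V]

/-- Reading an instruction at a random vertex is measurable because there are only countably many
vertices. -/
theorem measurable_instruction {f : (ℕ → V → V × ℝ) → V} (hf : Measurable f) (n : ℕ) :
    Measurable fun ω : ℕ → V → V × ℝ => ω n (f ω) := by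
  have h : Measurable fun p : (ℕ → V → V × ℝ) × V => p.1 n p.2 :=
    measurable_from_prod_countable_left fun v =>
      (measurable_pi_apply v).comp (measurable_pi_apply n)
  exact h.comp (measurable_id.prodMk hf)

theorem measurable_chain (x : V) (n : ℕ) :
    Measurable fun ω : ℕ → V → V × ℝ => chain x ω n := by
  induction n with
  | zero => exact measurable_const
  | succ n ih => exact measurable_fst.comp (measurable_instruction ih n)

theorem measurable_arrivalTime (x : V) (n : ℕ) :
    Measurable fun ω : ℕ → V → V × ℝ => arrivalTime x ω n :=
  Finset.measurable_fun_sum _ fun i _ =>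
    measurable_snd.comp (measurable_instruction (measurable_chain x i) i)

theorem measurableSet_atEventWithin_prod (N : ℕ) (y : V) :
    MeasurableSet {p : (V × ℝ) × (ℕ → V → V × ℝ) | p.2 ∈ atEventWithin N p.1.1 p.1.2 y} := by
  have hchain : ∀ n, Measurable fun p : (V × ℝ) × (ℕ → V → V × ℝ) => chain p.1.1 p.2 n :=
    fun n => by
      have h : Measurable fun p : (ℕ → V → V × ℝ) × V => chain p.2 p.1 n :=
        measurable_from_prod_countable_left fun v => measurable_chain v n
      exact h.comp (measurable_snd.prodMk (measurable_fst.comp measurable_fst))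
  have harr : ∀ n, Measurable fun p : (V × ℝ) × (ℕ → V → V × ℝ) => arrivalTime p.1.1 p.2 n :=
    fun n => by
      have h : Measurable fun p : (ℕ → V → V × ℝ) × V => arrivalTime p.2 p.1 n :=
        measurable_from_prod_countable_left fun v => measurable_arrivalTime v n
      exact h.comp (measurable_snd.prodMk (measurable_fst.comp measurable_fst))
  have ht : Measurable fun p : (V × ℝ) × (ℕ → V → V × ℝ) => p.1.2 :=
    measurable_snd.comp measurable_fst
  simp only [atEventWithin, Set.mem_ofPred_eq]
  have : {p : (V × ℝ) × (ℕ → V → V × ℝ) | ∃ n ≤ N, arrivalTime p.1.1 p.2 n ≤ p.1.2 ∧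
      p.1.2 < arrivalTime p.1.1 p.2 (n + 1) ∧ chain p.1.1 p.2 n = y} =
      ⋃ n, ⋃ (_ : n ≤ N), {p | arrivalTime p.1.1 p.2 n ≤ p.1.2} ∩
        ({p | p.1.2 < arrivalTime p.1.1 p.2 (n + 1)} ∩ {p | chain p.1.1 p.2 n = y}) := by
    ext p
    simp only [Set.mem_ofPred_eq, Set.mem_iUnion, Set.mem_inter_iff, exists_prop]
  rw [this]
  exact MeasurableSet.iUnion fun n => MeasurableSet.iUnion fun _ =>
    (measurableSet_le (harr n) ht).inter ((measurableSet_lt ht (harr (n + 1))).inter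
      ((hchain n) (MeasurableSet.singleton y)))

end RandomWalk

/-! ### The first-jump recursion for the law of the walk. -/

namespace WeightedGraph

open RandomWalk

variable {V : Type*} [MeasurableSpace V] {Γ : WeightedGraph V} {θ : V → ℝ}

theorem lintegral_jumpLaw [DiscreteMeasurableSpace V] (x : V) (F : V → ℝ≥0∞) :
    ∫⁻ z, F z ∂Γ.jumpLaw x =
      ∑ z ∈ Γ.nbrs x, ENNReal.ofReal (Γ.weight x z / Γ.vertexWeight x) * F z := by
  rw [jumpLaw, lintegral_finsetSum_measure]
  exact Finset.sum_congr rfl fun z _ => by rw [lintegral_smul_measure, lintegral_dirac, smul_eq_mul]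

theorem map_drivingLaw [Infinite V] (hθ : ∀ x, 0 < θ x) (x : V) :
    (Γ.drivingLaw θ).map (fun ω => (ω 0 x, fun n => ω (n + 1))) =
      (Γ.instructionLaw θ x).prod (Γ.drivingLaw θ) := by
  have := Γ.isProbabilityMeasure_instructionLaw hθ
  have h := Measure.infinitePi_nat_map_head_tail
    (Measure.infinitePi fun x : V => Γ.instructionLaw θ x)
  have h2 := congrArg (Measure.map (Prod.map (fun f : V → V × ℝ => f x) id)) h
  rw [Measure.map_map (by fun_prop) (by fun_prop), ← Measure.map_prod_map _ _ (by fun_prop)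
    measurable_id, Measure.infinitePi_map_eval, Measure.map_id] at h2
  exact h2

theorem drivingLaw_firstWait [Infinite V] (hθ : ∀ x, 0 < θ x) (x : V) {t : ℝ} (ht : 0 ≤ t) :
    Γ.drivingLaw θ {ω | t < (ω 0 x).2} =
      ENNReal.ofReal (Real.exp (-(Γ.vertexWeight x / θ x * t))) := by
  have := Γ.isProbabilityMeasure_instructionLaw hθ
  have := Γ.isProbabilityMeasure_drivingLaw hθ
  have := Γ.isProbabilityMeasure_jumpLaw x
  have hr := div_pos (Γ.vertexWeight_pos x) (hθ x)
  have := isProbabilityMeasure_expMeasure hr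
  have hm : MeasurableSet {p : (V × ℝ) × (ℕ → V → V × ℝ) | t < p.1.2} :=
    measurableSet_lt measurable_const (by fun_prop)
  have h := congrArg (fun μ => μ {p : (V × ℝ) × (ℕ → V → V × ℝ) | t < p.1.2})
    (map_drivingLaw (Γ := Γ) hθ x)
  rw [Measure.map_apply (by fun_prop) hm] at h
  refine Eq.trans h ?_
  have hset : {p : (V × ℝ) × (ℕ → V → V × ℝ) | t < p.1.2} =
      (Set.univ ×ˢ Set.Ioi t) ×ˢ Set.univ := by ext p; simp
  rw [hset, Measure.prod_prod, instructionLaw, Measure.prod_prod, expMeasure_Ioi hr ht]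
  simp

variable (Γ θ) in
/-- The probability that the walk started at `x` is at `y` at time `t` after at most `N` jumps. -/
noncomputable def transitionWithin (N : ℕ) (x : V) (t : ℝ) (y : V) : ℝ≥0∞ :=
  Γ.drivingLaw θ (atEventWithin N x t y)

open Classical in
theorem transitionWithin_zero [Infinite V] (hθ : ∀ x, 0 < θ x) (x : V) {t : ℝ} (ht : 0 ≤ t) (y : V) :
    Γ.transitionWithin θ 0 x t y =
      if x = y then ENNReal.ofReal (Real.exp (-(Γ.vertexWeight x / θ x * t))) else 0 := by
  have h : atEventWithin 0 x t y = if x = y then {ω | t < (ω 0 x).2} else ∅ := by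
    ext ω
    rw [mem_atEventWithin_zero]
    split_ifs with hxy <;> simp [hxy, ht]
  rw [transitionWithin, h]
  split_ifs
  · exact drivingLaw_firstWait hθ x ht
  · exact measure_empty

variable [Countable V] [Infinite V] [DiscreteMeasurableSpace V]

/-- The Markov property at the first jump time. -/
theorem drivingLaw_tail_mem (hθ : ∀ x, 0 < θ x) (N : ℕ) (x : V) (t : ℝ) (y : V) {S : Set ℝ}
    (hS : MeasurableSet S) :
    Γ.drivingLaw θ {ω | (ω 0 x).2 ∈ S ∧
      (fun n => ω (n + 1)) ∈ atEventWithin N (ω 0 x).1 (t - (ω 0 x).2) y} =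
      ∑ z ∈ Γ.nbrs x, ENNReal.ofReal (Γ.weight x z / Γ.vertexWeight x) *
        ∫⁻ s in S, Γ.transitionWithin θ N z (t - s) y ∂expMeasure (Γ.vertexWeight x / θ x) := by
  have := Γ.isProbabilityMeasure_instructionLaw hθ
  have := Γ.isProbabilityMeasure_drivingLaw hθ
  have := Γ.isProbabilityMeasure_jumpLaw x
  have := isProbabilityMeasure_expMeasure (div_pos (Γ.vertexWeight_pos x) (hθ x))
  set E : Set ((V × ℝ) × (ℕ → V → V × ℝ)) :=
    {p | p.1.2 ∈ S ∧ p.2 ∈ atEventWithin N p.1.1 (t - p.1.2) y} with hE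
  have hφ : Measurable fun p : (V × ℝ) × (ℕ → V → V × ℝ) => ((p.1.1, t - p.1.2), p.2) := by
    fun_prop
  have hEm : MeasurableSet E :=
    ((measurable_snd.comp measurable_fst) hS).inter (hφ (measurableSet_atEventWithin_prod N y))
  have h := congrArg (fun μ => μ E) (map_drivingLaw (Γ := Γ) hθ x)
  rw [Measure.map_apply (by fun_prop) hEm] at h
  refine Eq.trans h ?_
  have hslice : ∀ p : V × ℝ, Γ.drivingLaw θ (Prod.mk p ⁻¹' E) =
      S.indicator (fun s => Γ.transitionWithin θ N p.1 (t - s) y) p.2 := fun p => by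
    by_cases hp : p.2 ∈ S
    · rw [Set.indicator_of_mem hp, transitionWithin]
      congr 1
      ext ω
      simp [hE, hp]
    · rw [Set.indicator_of_notMem hp]
      have : Prod.mk p ⁻¹' E = ∅ := by
        ext ω
        simp [hE, hp]
      rw [this, measure_empty]
  have hmeas : Measurable fun p : V × ℝ =>
      S.indicator (fun s => Γ.transitionWithin θ N p.1 (t - s) y) p.2 := by
    simp only [← hslice]
    exact measurable_measure_prodMk_left hEm
  rw [Measure.prod_apply hEm]
  simp only [hslice]
  rw [instructionLaw, lintegral_prod _ hmeas.aemeasurable, lintegral_jumpLaw]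
  refine Finset.sum_congr rfl fun z _ => ?_
  rw [← lintegral_indicator hS]

/-- Sample points with negative waiting times can make this event nonempty; they form a null set. -/
theorem transitionWithin_of_neg (hθ : ∀ x, 0 < θ x) (N : ℕ) (x : V) {t : ℝ} (ht : t < 0) (y : V) :
    Γ.transitionWithin θ N x t y = 0 := by
  induction N generalizing x t with
  | zero =>
    have : atEventWithin 0 x t y = ∅ := by
      ext ω
      rw [mem_atEventWithin_zero]
      simp [ht.not_ge]
    rw [transitionWithin, this, measure_empty]
  | succ N ih =>
    have h : atEventWithin (N + 1) x t y = {ω | (ω 0 x).2 ∈ Set.univ ∧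
      (fun n => ω (n + 1)) ∈ atEventWithin N (ω 0 x).1 (t - (ω 0 x).2) y} := by
      ext ω
      rw [mem_atEventWithin_succ]
      simp [ht.not_ge]
    rw [transitionWithin, h, drivingLaw_tail_mem hθ N x t y MeasurableSet.univ]
    refine Finset.sum_eq_zero fun z _ => ?_
    rw [Measure.restrict_univ, lintegral_congr_ae (g := fun _ => 0), lintegral_zero, mul_zero]
    filter_upwards [ae_expMeasure_pos (div_pos (Γ.vertexWeight_pos x) (hθ x))] with s hs
    exact ih z (by linarith)

open Classical in
theorem transitionWithin_succ (hθ : ∀ x, 0 < θ x) (N : ℕ) (x : V) {t : ℝ} (ht : 0 ≤ t) (y : V) :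
    Γ.transitionWithin θ (N + 1) x t y =
      (if x = y then ENNReal.ofReal (Real.exp (-(Γ.vertexWeight x / θ x * t))) else 0) +
      ∑ z ∈ Γ.nbrs x, ENNReal.ofReal (Γ.weight x z / Γ.vertexWeight x) *
        ∫⁻ s in Set.Iic t, Γ.transitionWithin θ N z (t - s) y
          ∂expMeasure (Γ.vertexWeight x / θ x) := by
  set E : Set ℝ → Set (ℕ → V → V × ℝ) := fun S => {ω | (ω 0 x).2 ∈ S ∧
    (fun n => ω (n + 1)) ∈ atEventWithin N (ω 0 x).1 (t - (ω 0 x).2) y} with hE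
  have hEm : ∀ S, MeasurableSet S → MeasurableSet (E S) := fun S hS => by
    have hφ : Measurable fun ω : ℕ → V → V × ℝ =>
        (((ω 0 x).1, t - (ω 0 x).2), fun n => ω (n + 1)) := by fun_prop
    have hψ : Measurable fun ω : ℕ → V → V × ℝ => (ω 0 x).2 := by fun_prop
    exact (hψ hS).inter (hφ (measurableSet_atEventWithin_prod N y))
  have hset : atEventWithin (N + 1) x t y =
      (atEventWithin 0 x t y ∪ E (Set.Iic t)) ∪ E (Set.Ioi t) := by
    ext ω
    rw [mem_atEventWithin_succ, Set.mem_union, Set.mem_union, mem_atEventWithin_zero, or_assoc]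
    refine or_congr_right ?_
    simp only [hE, Set.mem_ofPred_eq, ← or_and_right, Set.mem_Iic, Set.mem_Ioi, le_or_gt, true_and]
  have hnull : Γ.drivingLaw θ (E (Set.Ioi t)) = 0 := by
    rw [hE, drivingLaw_tail_mem hθ N x t y measurableSet_Ioi]
    refine Finset.sum_eq_zero fun z _ => ?_
    rw [setLIntegral_congr_fun measurableSet_Ioi (g := fun _ => 0), lintegral_zero, mul_zero]
    intro s hs
    exact transitionWithin_of_neg hθ N z (sub_neg.2 hs) y
  have hdisj : Disjoint (atEventWithin 0 x t y) (E (Set.Iic t)) := by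
    rw [Set.disjoint_left]
    intro ω h1 h2
    exact absurd h2.1 (not_le.2 (mem_atEventWithin_zero.1 h1).2.1)
  rw [transitionWithin, hset,
    measure_congr (union_ae_eq_left_of_ae_eq_empty (ae_eq_empty.2 hnull)),
    measure_union hdisj (hEm _ measurableSet_Iic), ← transitionWithin, transitionWithin_zero hθ x ht,
    ← drivingLaw_tail_mem hθ N x t y measurableSet_Iic]

end WeightedGraph

/-! ### Identification of the heat kernel as the supremum of the killed kernels. -/

namespace WeightedGraph

open RandomWalk

section Duhamel

variable {V : Type*} {Γ : WeightedGraph V} {θ : V → ℝ} {B : Finset V}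

theorem continuous_killedTransition (x y : V) :
    Continuous fun t => Γ.killedTransition θ B t x y := by
  by_cases hx : x ∈ B
  · exact continuous_iff_continuousAt.2 fun t =>
      (hasDerivAt_killedTransition hx y t).continuousAt
  · simp only [killedTransition_of_notMem_left hx]
    exact continuous_const

open Classical in
/-- Duhamel's formula for the killed walk: decomposition at the first jump time. -/
theorem ofReal_killedTransition [Infinite V] (hθ : ∀ x, 0 < θ x) {x : V} (hx : x ∈ B) {t : ℝ}
    (ht : 0 ≤ t) (y : V) :
    ENNReal.ofReal (Γ.killedTransition θ B t x y) =
      (if x = y then ENNReal.ofReal (Real.exp (-(Γ.vertexWeight x / θ x * t))) else 0) +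
      ∑ z ∈ Γ.nbrs x, ENNReal.ofReal (Γ.weight x z / Γ.vertexWeight x) *
        ∫⁻ s in Set.Iic t, ENNReal.ofReal (Γ.killedTransition θ B (t - s) z y)
          ∂expMeasure (Γ.vertexWeight x / θ x) := by
  set U := Γ.killedTransition θ B with hU
  set r := Γ.vertexWeight x / θ x with hr
  have hπ := Γ.vertexWeight_pos x
  have hr0 : 0 < r := div_pos hπ (hθ x)
  have hcont : ∀ z, Continuous fun s => U (t - s) z y := fun z =>
    (continuous_killedTransition z y).comp (continuous_const.sub continuous_id)
  have hcont' : ∀ z, Continuous fun s => r * Real.exp (-(r * s)) * U (t - s) z y := fun z =>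
    (by fun_prop : Continuous fun s => r * Real.exp (-(r * s))).mul (hcont z)
  have hnn : ∀ z, ∀ s ∈ Set.Icc 0 t, 0 ≤ U (t - s) z y := fun z s hs =>
    killedTransition_nonneg hθ (sub_nonneg.2 hs.2) z y
  -- Variation of constants: the factor `e^{-rs}` cancels the diagonal part of the generator, and
  -- integrating over `[0, t]` gives the first-jump formula.
  have hderiv : ∀ s, HasDerivAt (fun s => -Real.exp (-(r * s)) * U (t - s) x y)
      (∑ z ∈ Γ.nbrs x, Γ.weight x z / Γ.vertexWeight x *
        (r * Real.exp (-(r * s)) * U (t - s) z y)) s := by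
    intro s
    have h1 := (hasDerivAt_killedTransition (Γ := Γ) (θ := θ) hx y (t - s)).scomp s
      ((hasDerivAt_id s).const_sub t)
    refine ((hasDerivAt_neg_exp_mul_exp (r := r) (x := s)).mul h1).congr_deriv ?_
    simp only [Function.comp, smul_eq_mul]
    have e1 : ∑ z ∈ Γ.nbrs x, Γ.weight x z *
        (Γ.killedTransition θ B (t - s) z y - Γ.killedTransition θ B (t - s) x y) =
        ∑ z ∈ Γ.nbrs x, Γ.weight x z * U (t - s) z y - Γ.vertexWeight x * U (t - s) x y := by
      simp only [mul_sub, Finset.sum_sub_distrib, ← Finset.sum_mul, vertexWeight, hU]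
    have e2 : ∑ z ∈ Γ.nbrs x, Γ.weight x z / Γ.vertexWeight x *
        (r * Real.exp (-(r * s)) * U (t - s) z y) =
        Real.exp (-(r * s)) / θ x * ∑ z ∈ Γ.nbrs x, Γ.weight x z * U (t - s) z y := by
      rw [Finset.mul_sum]
      refine Finset.sum_congr rfl fun z _ => ?_
      rw [hr]
      have := (hθ x).ne'
      field_simp
    rw [e1, e2, hr]
    have := (hθ x).ne'
    field_simp
    ring
  have hftc := intervalIntegral.integral_eq_sub_of_hasDerivAt (a := 0) (b := t)
    (fun s _ => hderiv s) (Continuous.intervalIntegrable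
      (continuous_finsetSum _ fun z _ => continuous_const.mul (hcont' z)) _ _)
  rw [intervalIntegral.integral_finsetSum (f := fun z s => Γ.weight x z / Γ.vertexWeight x *
    (r * Real.exp (-(r * s)) * U (t - s) z y)) fun z _ =>
      (continuous_const.mul (hcont' z)).intervalIntegrable _ _] at hftc
  simp only [intervalIntegral.integral_const_mul, sub_self, sub_zero, mul_zero, neg_zero,
    Real.exp_zero] at hftc
  have hU0 : U 0 x y = if x = y then 1 else 0 := killedTransition_zero hx
  have hI0 : ∀ z, 0 ≤ ∫ s in 0..t, r * Real.exp (-(r * s)) * U (t - s) z y := fun z =>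
    intervalIntegral.integral_nonneg ht fun s hs => by
      have := hnn z s hs
      positivity
  have hmain : U t x y = (if x = y then Real.exp (-(r * t)) else 0) +
      ∑ z ∈ Γ.nbrs x, Γ.weight x z / Γ.vertexWeight x *
        ∫ s in 0..t, r * Real.exp (-(r * s)) * U (t - s) z y := by
    rw [hftc, hU0]
    split_ifs <;> ring
  rw [hmain, ENNReal.ofReal_add (by split_ifs <;> positivity)
    (Finset.sum_nonneg fun z _ => mul_nonneg (div_nonneg (Γ.weight_nonneg _ _) hπ.le) (hI0 z)),
    ENNReal.ofReal_sum_of_nonneg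
      fun z _ => mul_nonneg (div_nonneg (Γ.weight_nonneg _ _) hπ.le) (hI0 z)]
  congr 1
  · split_ifs <;> simp
  · refine Finset.sum_congr rfl fun z _ => ?_
    rw [ENNReal.ofReal_mul (div_nonneg (Γ.weight_nonneg _ _) hπ.le),
      setLIntegral_Iic_expMeasure hr0 ht (hcont z) (hnn z)]

end Duhamel

/-- All vertices that can be reached from `x` in at most `N` jumps lie in `B`. -/
def ReachWithin {V : Type*} (Γ : WeightedGraph V) (B : Finset V) : ℕ → V → Prop
  | 0, x => x ∈ B
  | N + 1, x => x ∈ B ∧ ∀ z ∈ Γ.nbrs x, ReachWithin Γ B N z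

theorem ReachWithin.mono {V : Type*} {Γ : WeightedGraph V} {B B' : Finset V} (hB : B ⊆ B') {N : ℕ}
    {x : V} (h : Γ.ReachWithin B N x) : Γ.ReachWithin B' N x := by
  induction N generalizing x with
  | zero => exact hB h
  | succ N ih => exact ⟨hB h.1, fun z hz => ih (h.2 z hz)⟩

theorem exists_reachWithin {V : Type*} (Γ : WeightedGraph V) (N : ℕ) (x : V) :
    ∃ B, Γ.ReachWithin B N x := by
  classical
  induction N generalizing x with
  | zero => exact ⟨{x}, Finset.mem_singleton_self x⟩
  | succ N ih =>
    choose B hB using ih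
    refine ⟨insert x ((Γ.nbrs x).biUnion B), Finset.mem_insert_self _ _, fun z hz => ?_⟩
    exact (hB z).mono ((Finset.subset_biUnion_of_mem B hz).trans (Finset.subset_insert _ _))

variable {V : Type*} [Countable V] [Infinite V] [MeasurableSpace V] [DiscreteMeasurableSpace V]
  {Γ : WeightedGraph V} {θ : V → ℝ} {B : Finset V}

/-- Both sides satisfy the same first-jump recursion, and as long as `N` jumps cannot leave `B` the
killing is not felt. -/
theorem transitionWithin_le_killedTransition (hθ : ∀ x, 0 < θ x) {N : ℕ} {x : V}
    (h : Γ.ReachWithin B N x) {t : ℝ} (ht : 0 ≤ t) (y : V) :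
    Γ.transitionWithin θ N x t y ≤ ENNReal.ofReal (Γ.killedTransition θ B t x y) := by
  classical
  induction N generalizing x t with
  | zero =>
    rw [transitionWithin_zero hθ x ht, ofReal_killedTransition hθ h ht]
    exact le_self_add
  | succ N ih =>
    rw [transitionWithin_succ hθ N x ht, ofReal_killedTransition hθ h.1 ht]
    gcongr (_ + ∑ z ∈ _, _ * ?_) with z hz
    exact setLIntegral_mono' measurableSet_Iic fun s hs =>
      ih (h.2 z hz) (sub_nonneg.2 (Set.mem_Iic.1 hs))

/-- The same recursion in the other direction: each jump from a vertex of `B` within time `T` has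
probability at most `ρ`, so the truncation error contracts by `ρ` per jump. -/
theorem killedTransition_le_transitionWithin_add (hθ : ∀ x, 0 < θ x) {T K ρ : ℝ} (hK0 : 0 ≤ K)
    (hρ0 : 0 ≤ ρ) (hK : ∀ t ∈ Set.Icc 0 T, ∀ x y, Γ.killedTransition θ B t x y ≤ K)
    (hρ : ∀ x ∈ B, 1 - Real.exp (-(Γ.vertexWeight x / θ x * T)) ≤ ρ) (N : ℕ) (x : V) {t : ℝ}
    (ht : t ∈ Set.Icc 0 T) (y : V) :
    ENNReal.ofReal (Γ.killedTransition θ B t x y) ≤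
      Γ.transitionWithin θ N x t y + ENNReal.ofReal (K * ρ ^ N) := by
  classical
  induction N generalizing x t with
  | zero =>
    rw [pow_zero, mul_one]
    exact (ENNReal.ofReal_le_ofReal (hK t ht x y)).trans le_add_self
  | succ N ih =>
    by_cases hx : x ∈ B
    swap
    · rw [killedTransition_of_notMem_left hx, ENNReal.ofReal_zero]
      exact zero_le
    have hr := div_pos (Γ.vertexWeight_pos x) (hθ x)
    have hπ := Γ.vertexWeight_pos x
    rw [transitionWithin_succ hθ N x ht.1, ofReal_killedTransition hθ hx ht.1, add_assoc]
    gcongr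
    have hexp : expMeasure (Γ.vertexWeight x / θ x) (Set.Iic t) ≤ ENNReal.ofReal ρ := by
      rw [expMeasure_Iic hr ht.1]
      refine ENNReal.ofReal_le_ofReal (le_trans ?_ (hρ x hx))
      have := ht.2
      gcongr
    have hsum : ∑ z ∈ Γ.nbrs x, ENNReal.ofReal (Γ.weight x z / Γ.vertexWeight x) = 1 := by
      rw [← ENNReal.ofReal_sum_of_nonneg fun z _ => div_nonneg (Γ.weight_nonneg _ _) hπ.le,
        ← Finset.sum_div, ← vertexWeight, div_self hπ.ne', ENNReal.ofReal_one]
    calc _ ≤ ∑ z ∈ Γ.nbrs x, ENNReal.ofReal (Γ.weight x z / Γ.vertexWeight x) *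
          (∫⁻ s in Set.Iic t, Γ.transitionWithin θ N z (t - s) y
            ∂expMeasure (Γ.vertexWeight x / θ x) + ENNReal.ofReal (K * ρ ^ (N + 1))) := by
          gcongr with z hz
          calc _ ≤ ∫⁻ s in Set.Iic t, (Γ.transitionWithin θ N z (t - s) y +
                ENNReal.ofReal (K * ρ ^ N)) ∂expMeasure (Γ.vertexWeight x / θ x) := by
                refine setLIntegral_mono_ae' measurableSet_Iic ?_
                filter_upwards [ae_expMeasure_pos hr] with s hs0 hs
                exact ih z ⟨sub_nonneg.2 hs, by linarith [ht.2]⟩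
            _ = _ + ENNReal.ofReal (K * ρ ^ N) *
                expMeasure (Γ.vertexWeight x / θ x) (Set.Iic t) := by
                rw [lintegral_add_right _ measurable_const, setLIntegral_const]
            _ ≤ _ := by
                rw [pow_succ, ← mul_assoc, ENNReal.ofReal_mul (p := K * ρ ^ N) (by positivity)]
                gcongr
      _ = _ := by
          simp only [mul_add, Finset.sum_add_distrib]
          rw [← Finset.sum_mul, hsum, one_mul]

theorem killedTransition_le_measureReal_atEvent (hθ : ∀ x, 0 < θ x) (x y : V) {t : ℝ}
    (ht : 0 ≤ t) : Γ.killedTransition θ B t x y ≤ (Γ.drivingLaw θ).real (atEvent x t y) := by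
  classical
  have := Γ.isProbabilityMeasure_drivingLaw hθ
  obtain ⟨K, hK0, hK⟩ : ∃ K, 0 ≤ K ∧
      ∀ s ∈ Set.Icc 0 t, ∀ x y, Γ.killedTransition θ B s x y ≤ K := by
    have hcont : Continuous fun s => ∑ x ∈ B, ∑ y ∈ B, |Γ.killedTransition θ B s x y| :=
      continuous_finsetSum _ fun x _ => continuous_finsetSum _ fun y _ =>
        (continuous_killedTransition x y).abs
    obtain ⟨K, hK⟩ := isCompact_Icc.exists_bound_of_continuousOn (s := Set.Icc 0 t)
      hcont.continuousOn
    have hK0 : 0 ≤ K := (norm_nonneg _).trans (hK 0 ⟨le_rfl, ht⟩)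
    refine ⟨K, hK0, fun s hs x y => ?_⟩
    by_cases hx : x ∈ B
    · by_cases hy : y ∈ B
      · refine le_trans ?_ ((le_abs_self _).trans (hK s hs))
        refine (le_abs_self _).trans ((Finset.single_le_sum (f := fun y =>
          |Γ.killedTransition θ B s x y|) (fun _ _ => abs_nonneg _) hy).trans ?_)
        exact Finset.single_le_sum (f := fun x => ∑ y ∈ B, |Γ.killedTransition θ B s x y|)
          (fun _ _ => Finset.sum_nonneg fun _ _ => abs_nonneg _) hx
      · rwa [killedTransition_of_notMem_right hy]
    · rwa [killedTransition_of_notMem_left hx]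
  obtain ⟨ρ, hρ0, hρ1, hρ⟩ : ∃ ρ, 0 ≤ ρ ∧ ρ < 1 ∧
      ∀ x ∈ B, 1 - Real.exp (-(Γ.vertexWeight x / θ x * t)) ≤ ρ := by
    -- The sum of the jump rates over the finite set `B` bounds each of them, which gives a common
    -- `ρ < 1`.
    set r := ∑ x ∈ B, Γ.vertexWeight x / θ x
    have hr0 : ∀ x, 0 ≤ Γ.vertexWeight x / θ x := fun x =>
      (div_pos (Γ.vertexWeight_pos x) (hθ x)).le
    have hr : 0 ≤ r := Finset.sum_nonneg fun x _ => hr0 x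
    refine ⟨1 - Real.exp (-(r * t)), ?_, ?_, fun x hx => ?_⟩
    · rw [sub_nonneg, Real.exp_le_one_iff]
      have := mul_nonneg hr ht
      linarith
    · have := Real.exp_pos (-(r * t))
      linarith
    · have := Finset.single_le_sum (f := fun x => Γ.vertexWeight x / θ x) (fun x _ => hr0 x) hx
      gcongr
  have hN : ∀ N : ℕ, Γ.killedTransition θ B t x y ≤
      (Γ.drivingLaw θ).real (atEvent x t y) + K * ρ ^ N := by
    intro N
    have h1 := killedTransition_le_transitionWithin_add (Γ := Γ) (B := B) hθ hK0 hρ0 hK hρ N x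
      ⟨ht, le_rfl⟩ y
    have h2 : Γ.transitionWithin θ N x t y ≤ Γ.drivingLaw θ (atEvent x t y) := by
      rw [atEvent_eq_iUnion]
      exact measure_mono (Set.subset_iUnion (fun N => atEventWithin N x t y) N)
    have h3 := h1.trans (add_le_add_left h2 _)
    rw [← ofReal_measureReal, ← ENNReal.ofReal_add measureReal_nonneg (by positivity)] at h3
    exact (ENNReal.ofReal_le_ofReal_iff (add_nonneg measureReal_nonneg (by positivity))).1 h3
  have hlim : Filter.Tendsto (fun N : ℕ => (Γ.drivingLaw θ).real (atEvent x t y) + K * ρ ^ N)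
      Filter.atTop (nhds ((Γ.drivingLaw θ).real (atEvent x t y) + K * 0)) :=
    ((tendsto_pow_atTop_nhds_zero_of_lt_one hρ0 hρ1).const_mul K).const_add _
  have := ge_of_tendsto' hlim hN
  simpa using this

/-- The events with at most `N` jumps increase to the full event, and by local finiteness each is
captured by some finite `B`. -/
theorem measureReal_atEvent_le (hθ : ∀ x, 0 < θ x) (x y : V) {t c : ℝ} (ht : 0 ≤ t)
    (h : ∀ B : Finset V, x ∈ B → y ∈ B → Γ.killedTransition θ B t x y ≤ c) :
    (Γ.drivingLaw θ).real (atEvent x t y) ≤ c := by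
  classical
  have hc : 0 ≤ c := (killedTransition_nonneg (B := {x, y}) hθ ht x y).trans
    (h {x, y} (by simp) (by simp))
  refine ENNReal.toReal_le_of_le_ofReal hc ?_
  rw [atEvent_eq_iUnion, (atEventWithin_mono x t y).measure_iUnion]
  refine iSup_le fun N => ?_
  obtain ⟨B, hB⟩ := Γ.exists_reachWithin N x
  have hB' := hB.mono (B' := insert x (insert y B))
    ((Finset.subset_insert _ _).trans (Finset.subset_insert _ _))
  exact (transitionWithin_le_killedTransition hθ hB' ht y).trans
    (ENNReal.ofReal_le_ofReal (h _ (by simp) (by simp)))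

end WeightedGraph

/-! ### The off-diagonal Gaussian bound. -/

theorem theorem1p3 (γ : ℝ) (hγ : 1 < γ) :
    ∃ α > (0 : ℝ), ∃ C₂ > (0 : ℝ), ∀ (A Cθ : ℝ), 1 ≤ A → 0 < Cθ → ∃ C₁ > (0 : ℝ),
      ∀ (V : Type*) [Countable V] [Infinite V] [MeasurableSpace V] [DiscreteMeasurableSpace V]
        [MetricSpace V] (Γ : WeightedGraph V) (θ : V → ℝ),
        (∀ x, Cθ ≤ θ x) → Γ.IsAdaptedMetric θ →
        ∀ (T₁ : ℝ) (T₂ : EReal) (f₁ f₂ : ℝ → ℝ) (v₁ v₂ : V),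
          IsRegularOn A γ T₁ T₂ f₁ → IsRegularOn A γ T₁ T₂ f₂ →
          (∀ t ∈ timeInterval T₁ T₂,
            f₁ t / Real.exp (Real.sqrt t) ≤ A ∧ f₂ t / Real.exp (Real.sqrt t) ≤ A) →
          (∀ t ∈ timeInterval T₁ T₂,
            Γ.heatKernel θ t v₁ v₁ ≤ 1 / f₁ t ∧ Γ.heatKernel θ t v₂ v₂ ≤ 1 / f₂ t) →
          ∀ t : ℝ, max (max (72 * γ ^ 4 * Real.exp 1 ^ 4 * T₁ ^ 2) 1) (dist v₁ v₂) < t →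
            (t : EReal) < T₂ →
            α * t ∈ timeInterval T₁ T₂ ∧
              Γ.heatKernel θ t v₁ v₂ ≤
                C₁ / Real.sqrt (f₁ (α * t) * f₂ (α * t)) *
                  Real.exp (-C₂ * (dist v₁ v₂ ^ 2 / t)) := by
  obtain ⟨c, hc, H⟩ := WeightedGraph.killedTail_le_gaussian hγ
  have hγ0 : 0 < γ := by linarith
  -- The tail radius `d / 2` contributes a factor 1/4 to the exponent and the square root of the
  -- tail a factor 1/2, hence `c / 8`.
  refine ⟨1 / γ, by positivity, c / 8, by positivity, fun A Cθ hA hCθ => ?_⟩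
  obtain ⟨C, hC1, H⟩ := H A Cθ hA hCθ
  have hC0 : 0 < C := by linarith
  refine ⟨2 * √C, by positivity, ?_⟩
  intro V _ _ _ _ _ Γ θ hθC hd T₁ T₂ f₁ f₂ v₁ v₂ hf₁ hf₂ hexp hdiag t ht htT₂
  have hθ : ∀ x, 0 < θ x := fun x => hCθ.trans_le (hθC x)
  have htD : dist v₁ v₂ < t := (le_max_right _ _).trans_lt ht
  have ht1 : 1 < t := ((le_max_right _ _).trans (le_max_left _ _)).trans_lt ht
  have htT : 72 * γ ^ 4 * Real.exp 1 ^ 4 * T₁ ^ 2 < t :=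
    ((le_max_left _ _).trans (le_max_left _ _)).trans_lt ht
  have ht0 : 0 < t := by linarith
  have hT₁ := hf₁.nonneg
  have htT' : (2 * γ) ^ 2 * T₁ ^ 2 < t := by
    refine lt_of_le_of_lt ?_ htT
    gcongr
    have h1 : 1 ≤ Real.exp 1 ^ 4 := one_le_pow₀ (Real.one_le_exp zero_le_one)
    have h2 : 1 ≤ γ ^ 2 := one_le_pow₀ hγ.le
    calc (2 * γ) ^ 2 = 4 * γ ^ 2 * 1 * 1 := by ring
      _ ≤ 72 * γ ^ 2 * γ ^ 2 * Real.exp 1 ^ 4 := by gcongr; norm_num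
      _ = _ := by ring
  have htγ : γ * T₁ < t := by
    refine lt_of_pow_lt_pow_left₀ 2 ht0.le ?_
    rw [mul_pow]
    nlinarith [mul_nonneg (sq_nonneg γ) (sq_nonneg T₁)]
  rw [one_div_mul_eq_div]
  have hmemt : t ∈ timeInterval T₁ T₂ := ⟨by nlinarith, htT₂⟩
  have hmemγ := hf₁.div_mem htγ htT₂
  refine ⟨hmemγ, ?_⟩
  have hpos₁ := hf₁.pos _ hmemγ
  have hpos₂ := hf₂.pos _ hmemγ
  have hkill : ∀ (B : Finset V) (v : V), ∀ s ∈ timeInterval T₁ T₂,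
      Γ.killedTransition θ B s v v / θ v ≤ Γ.heatKernel θ s v v := fun B v s hs =>
    div_le_div_of_nonneg_right
      (WeightedGraph.killedTransition_le_measureReal_atEvent hθ v v (hT₁.trans hs.1.le)) (hθ v).le
  have hdiv : t / γ ≤ t := div_le_self ht0.le hγ.le
  -- One tail factor and one on-diagonal factor; monotonicity moves the latter from time `t` to `t /
  -- γ`, so that both functions are evaluated at the same time.
  have hterm : ∀ {f g : ℝ → ℝ} {a b : ℝ}, 0 < f (t / γ) → 0 < g (t / γ) →
      g (t / γ) ≤ g t → a ≤ C * Real.exp (-(c * ((dist v₁ v₂ / 2) ^ 2 / t))) / f (t / γ) →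
      b ≤ 1 / g t →
      √a * √b ≤ √C / √(f (t / γ) * g (t / γ)) * Real.exp (-(c / 8) * (dist v₁ v₂ ^ 2 / t)) := by
    intro f g a b hf hg hgt ha hb
    have hb' : b ≤ 1 / g (t / γ) := hb.trans (one_div_le_one_div_of_le hg hgt)
    have hsqrt : √(Real.exp (-(c * ((dist v₁ v₂ / 2) ^ 2 / t)))) =
        Real.exp (-(c / 8) * (dist v₁ v₂ ^ 2 / t)) := by
      rw [← Real.exp_half]
      congr 1
      ring
    calc √a * √b ≤ √(C * Real.exp (-(c * ((dist v₁ v₂ / 2) ^ 2 / t))) / f (t / γ)) *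
          √(1 / g (t / γ)) := by gcongr
      _ = _ := by
        rw [Real.sqrt_div (by positivity), Real.sqrt_mul hC0.le, hsqrt, Real.sqrt_div zero_le_one,
          Real.sqrt_one, Real.sqrt_mul hf.le]
        ring
  rw [WeightedGraph.heatKernel, div_le_iff₀ (hθ v₂)]
  refine WeightedGraph.measureReal_atEvent_le hθ v₁ v₂ ht0.le fun B hv₁ hv₂ => ?_
  rw [← div_le_iff₀ (hθ v₂)]
  have hdiag₁ : ∀ s ∈ timeInterval T₁ T₂, Γ.killedTransition θ B s v₁ v₁ / θ v₁ ≤ 1 / f₁ s :=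
    fun s hs => (hkill B v₁ s hs).trans (hdiag s hs).1
  have hdiag₂ : ∀ s ∈ timeInterval T₁ T₂, Γ.killedTransition θ B s v₂ v₂ / θ v₂ ≤ 1 / f₂ s :=
    fun s hs => (hkill B v₂ s hs).trans (hdiag s hs).2
  have hD : dist v₁ v₂ / 2 ≤ t / 2 := by linarith
  have hI₁ := H hθC hd hv₁ hf₁ (fun s hs => (div_le_iff₀ (Real.exp_pos _)).1 (hexp s hs).1) hdiag₁
    (dist v₁ v₂ / 2) t htT' htγ htT₂ (by positivity) hD
  have hI₂ := H hθC hd hv₂ hf₂ (fun s hs => (div_le_iff₀ (Real.exp_pos _)).1 (hexp s hs).2) hdiag₂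
    (dist v₁ v₂ / 2) t htT' htγ htT₂ (by positivity) hD
  have hsplit := WeightedGraph.killedTransition_le_sqrt_add_sqrt (Γ := Γ) (B := B) hθ v₁ v₂ (t / 2)
  rw [add_halves] at hsplit
  have h1 := hterm hpos₁ hpos₂ (hf₂.monotoneOn hmemγ hmemt hdiv) hI₁ (hdiag₂ t hmemt)
  have h2 := hterm hpos₂ hpos₁ (hf₁.monotoneOn hmemγ hmemt hdiv) hI₂ (hdiag₁ t hmemt)
  rw [mul_comm (f₂ (t / γ))] at h2
  refine (hsplit.trans (add_le_add h1 h2)).trans_eq ?_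
  ring
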